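/- Let $n\ge 0$ and let $\kappa^{(N)}(x_{ab};\,1\le a<b\le N)$, $N\ge 2$, be smooth real functions with $\kappa^{(2)}=\rho$, $\rho(0)=1$ and $\gamma:=-\rho'(0)>0$. (They are the $N$-point correlation functions of a centred, unit-variance, isotropic, weakly non-Gaussian random field $X$ on $\mathbb{R}^n$, i.e. $\mathrm{cum}(X(t_1),\dots,X(t_N))=\nu^{N-2}\kappa^{(N)}\bigl((\tfrac12\|t_a-t_b\|^2)_{a<b}\bigr)$.) For $N=u+v+w$, a scalar $s$, a vector $T$ of length $n$ and $\Theta\in\mathrm{Sym}(n)$ put $$K_{u,v,w}(s,T,\Theta)=s^u\prod_{b=u+1}^{u+v}\langle T,\nabla_{t_b}\rangle\prod_{c=u+v+1}^{N}\mathrm{tr}(\Theta\nabla_{t_c}^2)\;\kappa^{(N)}\bigl((\tfrac12\|t_a-t_{a'}\|^2)_{a<a'}\bigr)\Big|_{t_1=\dots=t_N},\qquad Q_N=\sum_{u+v+w=N}\frac{K_{u,v,w}}{u!\,v!\,w!},$$ and let $$\psi(s,T,\Theta)=e^{Q_2}\exp\Bigl(\sum_{N\ge 3}\nu^{N-2}Q_N\Bigr)=e^{Q_2}\Bigl(1+\nu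 Q_3+\nu^2\bigl(Q_4+\tfrac12Q_3^2\bigr)+\cdots\Bigr)$$ be the expansion in powers of $\nu$ of the moment generating function of $(X,\nabla X,\nabla^2X)$. The perturbation (asymptotic) expansion $\sum_{m\ge 0}\nu^m\,\Xi_{n,m}(v)$ of the Euler characteristic density $\Xi_n(v)$ is obtained by inserting it, term by term, into $$\Xi_n(v)=\int_v^\infty\Bigl[\det(-D_\Theta+\gamma xI_n)\Big|_{\Theta=0}\frac1{2\pi}\int_{\mathbb{R}}e^{-isx}\,\frac{1}{(2\pi)^{n}}\int_{\mathbb{R}^n}\psi\bigl(is+\gamma\,\mathrm{tr}(\Theta),\,iT,\,\Theta\bigr)\,dT\,ds\Bigr]dx,\qquad (D_\Theta)_{ij}=\frac{1+\delta_{ij}}2\frac{\partial}{\partial\Theta_{ij}}.$$ The diagram of a derivative $\bigl(\prod_{a<b}(\partial/\partial x_{ab})^{i_{ab}}\bigr)\kappa^{(N)}(0,\dots,0)$ is the multigraph on $\{1,\dots,N\}$ in which $a$ and $b$ are joined by $i_{ab}$ edges; a loop of length $K\ge2$ is a cycle through $K$ distinct vertices along $K$ distinct edges (two parallel edges form a loop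 of length 2). Theorem. If the diagram of a derivative of $\kappa^{(N)}$ at the origin has a loop of length $K\ge2$, then this derivative does not appear in the expansion of the Euler characteristic density, to any order. That is, for all $n$, $m$ and $v$ the coefficient $\Xi_{n,m}(v)$ is given, for all families $(\kappa^{(N)})$ as above, by one and the same real polynomial in $\gamma^{-1/2}$ and finitely many derivatives of the functions $\kappa^{(N)}$ at the origin, none of whose diagrams has a loop of length $\ge 2$. -/

import Mathlib

open scoped Nat ContDiff

noncomputable section

namespace ECDensity

/-! ### Point correlation functions, their derivatives at the origin, and diagrams -/

/-- Pairs `(a, b)` with `a < b` of elements of `{1, …, N}` (numbered from `0` here). -/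
abbrev Pair (N : ℕ) : Type := {p : Fin N × Fin N // p.1 < p.2}

/-- A family of functions `κ N = κ^{(N)}` of the `N (N - 1) / 2` real variables `x_{ab}`, `a < b`. -/
abbrev PointFunctions : Type := (N : ℕ) → (Pair N → ℝ) → ℝ

/-- The two-point function `ρ = κ^{(2)}` as a function of one real variable. -/
def rho (κ : PointFunctions) (y : ℝ) : ℝ := κ 2 (fun _ => y)

/-- `γ = - ρ'(0)`. -/
def gamma (κ : PointFunctions) : ℝ := - deriv (rho κ) 0

/-- A diagram: a multigraph on the vertex set `{1, …, N}` without self-loops, given by the list of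
its edges, each written as often as its multiplicity. -/
structure Diagram where
  /-- the number of points -/
  N : ℕ
  /-- the number of edges, counted with multiplicity -/
  size : ℕ
  /-- the edges -/
  edge : Fin size → Pair N

/-- The derivative `(∏_{(a,b)} ∂/∂x_{ab}) κ^{(N)} (0, …, 0)`, the product over all edges of the
diagram. (For smooth `κ^{(N)}` the order in which the edges are listed is immaterial.) -/
def Diagram.derivative (D : Diagram) (κ : PointFunctions) : ℝ :=
  iteratedFDeriv ℝ D.size (κ D.N) 0 (fun l => Pi.single (D.edge l) 1)

/-- The diagram contains a loop of length `K`: distinct vertices `p 0, …, p (K - 1)` and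
distinct edges `l 0, …, l (K - 1)` such that `l k` joins `p k` with `p (k + 1)`, where `k + 1` is
taken modulo `K`. Two parallel edges form a loop of length `2`. -/
def Diagram.HasLoop (D : Diagram) (K : ℕ) : Prop :=
  ∃ (p : Fin K → Fin D.N) (l : Fin K → Fin D.size),
    Function.Injective p ∧ Function.Injective l ∧
      ∀ k, s((D.edge (l k)).1.1, (D.edge (l k)).1.2) = s(p k, p (finRotate K k))

/-! ### The cumulants `K_{u,v,w}` -/

variable {N n : ℕ}

/-- `(‖t_a - t_b‖² / 2)_{a < b}` for points `t_1, …, t_N` of `ℝⁿ`. -/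
def halfSqDist (t : Fin N → Fin n → ℝ) : Pair N → ℝ :=
  fun p => (1 / 2) * ∑ i, (t p.1.1 i - t p.1.2 i) ^ 2

/-- `∂/∂t_a^i`. -/
def partialT (a : Fin N) (i : Fin n) (f : (Fin N → Fin n → ℝ) → ℂ) : (Fin N → Fin n → ℝ) → ℂ :=
  fun t => fderiv ℝ f t (Pi.single a (Pi.single i 1))

/-- `⟨T, ∇_{t_b}⟩`. -/
def gradOp (T : Fin n → ℂ) (b : Fin N) (f : (Fin N → Fin n → ℝ) → ℂ) :
    (Fin N → Fin n → ℝ) → ℂ :=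
  fun t => ∑ i, T i * partialT b i f t

/-- `tr(Θ ∇²_{t_c})`. -/
def hessOp (Θ : Matrix (Fin n) (Fin n) ℝ) (c : Fin N) (f : (Fin N → Fin n → ℝ) → ℂ) :
    (Fin N → Fin n → ℝ) → ℂ :=
  fun t => ∑ i, ∑ j, (Θ i j : ℂ) * partialT c i (partialT c j f) t

/-- `K_{u,v,w}(s, T, Θ)`, the joint cumulant (divided by `ν^{u+v+w-2}`) of `u` copies of `s X`, `v`
copies of `⟨T, ∇X⟩` and `w` copies of `tr(Θ ∇²X)`, namely
`s^u (∏_b ⟨T, ∇_{t_b}⟩ ∏_c tr(Θ ∇²_{t_c})) κ^{(N)}((‖t_a - t_{a'}‖² / 2)_{a<a'})` at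
`t_1 = ⋯ = t_N`, where `N = u + v + w` and `b`, `c` run over `u < b ≤ u + v`, `u + v < c ≤ N`. -/
def cumulantK (κ : PointFunctions) (u v w : ℕ) (s : ℂ) (T : Fin n → ℂ)
    (Θ : Matrix (Fin n) (Fin n) ℝ) : ℂ :=
  s ^ u *
    ((List.finRange v).foldr (fun b g => gradOp T (Fin.castAdd w (Fin.natAdd u b)) g)
      ((List.finRange w).foldr (fun c g => hessOp Θ (Fin.natAdd (u + v) c) g)
        (fun t => (κ (u + v + w) (halfSqDist t) : ℂ)))) 0

/-- `Q_N = ∑_{u+v+w=N} K_{u,v,w} / (u! v! w!)`. -/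
def cumulantQ (κ : PointFunctions) (N : ℕ) (s : ℂ) (T : Fin n → ℂ)
    (Θ : Matrix (Fin n) (Fin n) ℝ) : ℂ :=
  ∑ p ∈ Finset.HasAntidiagonal.antidiagonal N, ∑ q ∈ Finset.HasAntidiagonal.antidiagonal p.1,
    cumulantK κ q.1 q.2 p.2 s T Θ / ((q.1 ! : ℂ) * (q.2 ! : ℂ) * (p.2 ! : ℂ))

/-! ### The expansion of the moment generating function -/

/-- `ν Q_3 + ν² Q_4 + ν³ Q_5 + ⋯` as a formal power series in `ν`. -/
def higherCumulants (κ : PointFunctions) (s : ℂ) (T : Fin n → ℂ)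
    (Θ : Matrix (Fin n) (Fin n) ℝ) : PowerSeries ℂ :=
  PowerSeries.mk fun k => if k = 0 then 0 else cumulantQ κ (k + 2) s T Θ

/-- The coefficient of `ν^m` in
`ψ = exp (Q_2 + ν Q_3 + ν² Q_4 + ⋯) = exp (Q_2) * ∑_r (ν Q_3 + ν² Q_4 + ⋯)^r / r!`
(the terms with `r > m` do not contribute to it). -/
def mgfCoeff (κ : PointFunctions) (m : ℕ) (s : ℂ) (T : Fin n → ℂ)
    (Θ : Matrix (Fin n) (Fin n) ℝ) : ℂ :=
  Complex.exp (cumulantQ κ 2 s T Θ) *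
    ∑ r ∈ Finset.range (m + 1), PowerSeries.coeff m (higherCumulants κ s T Θ ^ r) / (r ! : ℂ)

/-- The coefficient of `ν^m` in `ψ_{V=0}(s, Θ) = (2π)^{-n} ∫_{ℝⁿ} ψ(s, i T, Θ) dT`. -/
def mgfVZeroCoeff (κ : PointFunctions) (m : ℕ) (s : ℂ) (Θ : Matrix (Fin n) (Fin n) ℝ) : ℂ :=
  (1 / (2 * Real.pi : ℂ) ^ n) *
    ∫ T : Fin n → ℝ, mgfCoeff κ m s (fun i => Complex.I * (T i : ℂ)) Θ

/-- The coefficient of `ν^m` in `(2π)^{-1} ∫_ℝ e^{- i s x} ψ_{V=0}(i s + γ tr(Θ), Θ) ds`. -/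
def fourierCoeff (κ : PointFunctions) (m : ℕ) (x : ℝ) (Θ : Matrix (Fin n) (Fin n) ℝ) : ℂ :=
  (1 / (2 * Real.pi : ℂ)) *
    ∫ s : ℝ, Complex.exp (-(Complex.I * (s : ℂ) * (x : ℂ))) *
      mgfVZeroCoeff κ m (Complex.I * (s : ℂ) + ((gamma κ * Θ.trace : ℝ) : ℂ)) Θ

/-! ### The determinantal differential operator and the density -/

/-- `(D_Θ)_{ij}`, that is `∂/∂θ_{ii}` for `i = j` and `(1/2) ∂/∂θ_{ij}` for `i ≠ j`, where
`θ_{ij} = θ_{ji}` is one variable on the space of symmetric matrices: the derivative in the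
direction of the symmetric matrix `(E_{ij} + E_{ji}) / 2`. -/
def DTheta (i j : Fin n) (f : Matrix (Fin n) (Fin n) ℝ → ℂ) : Matrix (Fin n) (Fin n) ℝ → ℂ :=
  fun Θ => lineDeriv ℝ f Θ ((1 / 2 : ℝ) • (Matrix.single i j 1 + Matrix.single j i 1))

/-- The entry `(i, j)` of the matrix of operators `- D_Θ + c I_n`. -/
def entryOp (c : ℝ) (i j : Fin n) (f : Matrix (Fin n) (Fin n) ℝ → ℂ) :
    Matrix (Fin n) (Fin n) ℝ → ℂ :=
  fun Θ => - DTheta i j f Θ + (if i = j then (c : ℂ) * f Θ else 0)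

/-- `det (- D_Θ + c I_n)`, by the Leibniz formula (the entries commute on smooth functions). -/
def detOp (c : ℝ) (f : Matrix (Fin n) (Fin n) ℝ → ℂ) : Matrix (Fin n) (Fin n) ℝ → ℂ :=
  fun Θ => ∑ σ : Equiv.Perm (Fin n), ((Equiv.Perm.sign σ : ℤ) : ℂ) *
    (List.finRange n).foldr (fun i g => entryOp c i (σ i) g) f Θ

/-- The coefficient of `ν^m` in the expansion of the Euler characteristic density
`Ξ_n(v) = ∫_v^∞ det(- D_Θ + γ x I_n) [(2π)^{-1} ∫_ℝ e^{- i s x} ψ_{V=0}(i s + γ tr(Θ), Θ) ds] dx`,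
the operator being evaluated at `Θ = 0`. -/
def eulerDensityCoeff (κ : PointFunctions) (n m : ℕ) (v : ℝ) : ℂ :=
  ∫ x in Set.Ioi v, detOp (gamma κ * x) (fourierCoeff (n := n) κ m x) 0

end ECDensity

end

/-! The half squared distances vanish at coinciding points and are homogeneous quadratic, so a
differential operator of order `2 * M` evaluated there sees only the `M`-th derivatives of `κ N`. A
derivative with diagram `G` enters multiplied by the operator applied to the product of `‖t_a -
t_b‖² / 2` over the edges of `G`. As a function of `Θ` this factor is a polynomial (`diagramPoly`).
The heart of the proof is that for a diagram with a loop this polynomial lies in `nullIdeal`: the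
determinantal operator at `Θ = 0` kills it even after multiplication by an arbitrary smooth
function. Since these functions form an ideal, such terms may be dropped inside products, powers and
exponentials.

Loop cancellation: the `K` edges of a loop give a product that vanishes to order `2 * K` at the
origin and involves only the `K` points of the loop. A point carries at most two derivatives, so all
loop points must carry a Hessian (`pairing_jetSymbol_eq_zero`). By the Leibniz rule the
determinantal operator assigns distinct rows to the factors `θ_{ij}` and, through the sign of the
permutation, antisymmetrizes their column indices (`sum_prod_coordFun_mem_nullIdeal`). This produces
a determinant of the operators `∂/∂t_{p k}^{s k'}`. The sum of its rows consists of generators of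
simultaneous translations of the loop, which annihilate functions of differences
(`pairing_det_mul_eq_zero`, `IsCycle.sum_sign_mul_pairing_eq_zero`).

The rest is control of the coefficients. The shift `s ↦ i s + γ tr Θ` cancels the mixed term of
`Q_2`, leaving Gaussian weights in `s` and `T`, the factor `exp(-(γ tr Θ)² / 2)`, and a form
proportional to `ρ''(0)`. The diagram of the latter is a double edge, so its exponential equals `1`
modulo `nullIdeal`. The integral over `T` gives powers of `γ^{-1/2}` and that over `s` a real
polynomial in `x` times `e^{-x²/2}`. The determinantal operator preserves this form, and evaluation
at `Θ = 0` followed by integration over `x` gives the polynomial. -/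

noncomputable section

namespace ECDensity

/-! ### Smooth functions of the matrix variable and the determinantal operator -/

/-- Smoothness of a complex function on the space of real `n × n` matrices. -/
def IsSmooth {n : ℕ} (f : Matrix (Fin n) (Fin n) ℝ → ℂ) : Prop :=
  ContDiff ℝ ∞ (fun A : Fin n → Fin n → ℝ => f (Matrix.of A))

theorem IsSmooth.contDiff {n : ℕ} {f : Matrix (Fin n) (Fin n) ℝ → ℂ} (hf : IsSmooth f) :
    ContDiff ℝ ∞ (fun A : Fin n → Fin n → ℝ => f (Matrix.of A)) := hf

/-- The algebra of smooth complex functions on the space of real `n × n` matrices. -/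
def smoothFun (n : ℕ) : Subalgebra ℂ (Matrix (Fin n) (Fin n) ℝ → ℂ) where
  carrier := {f | IsSmooth f}
  mul_mem' hf hg := (IsSmooth.contDiff hf).mul (IsSmooth.contDiff hg)
  add_mem' hf hg := (IsSmooth.contDiff hf).add (IsSmooth.contDiff hg)
  algebraMap_mem' c :=
    (contDiff_const : ContDiff ℝ ∞ (fun _ : Fin n → Fin n → ℝ => c))

theorem contDiff_of_mem {n : ℕ} {f : Matrix (Fin n) (Fin n) ℝ → ℂ} (hf : f ∈ smoothFun n) :
    ContDiff ℝ ∞ (fun A : Fin n → Fin n → ℝ => f (Matrix.of A)) := hf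

/-- The symmetric direction `(E_{ij} + E_{ji}) / 2`. -/
def symDir {n : ℕ} (i j : Fin n) : Matrix (Fin n) (Fin n) ℝ :=
  (1 / 2 : ℝ) • (Matrix.single i j 1 + Matrix.single j i 1)

/-- On smooth functions the line derivative is a Fréchet derivative on the space of plain two-index
arrays, which supplies linearity and the Leibniz rule for `thetaDeriv`. -/
theorem DTheta_eq_fderiv {n : ℕ} (i j : Fin n) {f : Matrix (Fin n) (Fin n) ℝ → ℂ}
    (hf : f ∈ smoothFun n) (Θ : Matrix (Fin n) (Fin n) ℝ) :
    DTheta i j f Θ =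
      fderiv ℝ (fun A : Fin n → Fin n → ℝ => f (Matrix.of A)) (Matrix.of.symm Θ)
        (Matrix.of.symm (symDir i j)) :=
  DifferentiableAt.lineDeriv_eq_fderiv (E := Fin n → Fin n → ℝ)
    (((contDiff_of_mem hf).differentiable (by simp)) (Matrix.of.symm Θ))

theorem DTheta_mem {n : ℕ} (i j : Fin n) {f : Matrix (Fin n) (Fin n) ℝ → ℂ}
    (hf : f ∈ smoothFun n) : DTheta i j f ∈ smoothFun n := by
  have h : DTheta i j f = fun Θ => fderiv ℝ (fun A : Fin n → Fin n → ℝ => f (Matrix.of A))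
      (Matrix.of.symm Θ) (Matrix.of.symm (symDir i j)) := funext (DTheta_eq_fderiv i j hf)
  rw [h]
  exact ((contDiff_of_mem hf).fderiv_right (m := ∞) (by simp)).clm_apply
    (contDiff_const (c := Matrix.of.symm (symDir i j)))

/-- `(D_Θ)_{ij}` as a derivation of the algebra of smooth functions. -/
def thetaDeriv {n : ℕ} (i j : Fin n) : Derivation ℂ (smoothFun n) (smoothFun n) :=
  Derivation.mk'
    { toFun := fun f => ⟨DTheta i j f.1, DTheta_mem i j f.2⟩
      map_add' := fun f g => by
        ext Θ
        have hf := (contDiff_of_mem f.2).differentiable (by simp) (Matrix.of.symm Θ)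
        have hg := (contDiff_of_mem g.2).differentiable (by simp) (Matrix.of.symm Θ)
        simp only [AddMemClass.mk_add_mk]
        change DTheta i j (f + g).1 Θ = DTheta i j f.1 Θ + DTheta i j g.1 Θ
        rw [DTheta_eq_fderiv i j f.2, DTheta_eq_fderiv i j g.2, DTheta_eq_fderiv i j (f + g).2]
        exact congrArg (fun L : (Fin n → Fin n → ℝ) →L[ℝ] ℂ => L (Matrix.of.symm (symDir i j)))
          (fderiv_add hf hg)
      map_smul' := fun c f => by
        ext Θ
        have hf := (contDiff_of_mem f.2).differentiable (by simp) (Matrix.of.symm Θ)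
        change DTheta i j (c • f).1 Θ = c * DTheta i j f.1 Θ
        rw [DTheta_eq_fderiv i j f.2, DTheta_eq_fderiv i j (c • f).2]
        exact congrArg (fun L : (Fin n → Fin n → ℝ) →L[ℝ] ℂ => L (Matrix.of.symm (symDir i j)))
          (fderiv_const_smul hf c) }
    (fun f g => by
      ext Θ
      have hf := (contDiff_of_mem f.2).differentiable (by simp) (Matrix.of.symm Θ)
      have hg := (contDiff_of_mem g.2).differentiable (by simp) (Matrix.of.symm Θ)
      change DTheta i j (f * g).1 Θ = f.1 Θ * DTheta i j g.1 Θ + g.1 Θ * DTheta i j f.1 Θ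
      rw [DTheta_eq_fderiv i j f.2, DTheta_eq_fderiv i j g.2, DTheta_eq_fderiv i j (f * g).2]
      exact congrArg (fun L : (Fin n → Fin n → ℝ) →L[ℝ] ℂ => L (Matrix.of.symm (symDir i j)))
          (fderiv_mul hf hg))

@[simp] theorem thetaDeriv_coe {n : ℕ} (i j : Fin n) (f : smoothFun n) :
    (thetaDeriv i j f).1 = DTheta i j f.1 := rfl

/-- The entry `(i, j)` of `- D_Θ + c I_n` as an endomorphism of the smooth functions. -/
def entryEnd {n : ℕ} (c : ℝ) (i j : Fin n) : Module.End ℂ (smoothFun n) :=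
  -(thetaDeriv i j : smoothFun n →ₗ[ℂ] smoothFun n) + (if i = j then (c : ℂ) • 1 else 0)

theorem entryEnd_apply {n : ℕ} (c : ℝ) (i j : Fin n) (f : smoothFun n) :
    entryEnd c i j f = - thetaDeriv i j f + (if i = j then (c : ℂ) • f else 0) := by
  unfold entryEnd
  split_ifs <;> simp

theorem entryEnd_coe {n : ℕ} (c : ℝ) (i j : Fin n) (f : smoothFun n) :
    (entryEnd c i j f).1 = entryOp c i j f.1 := by
  rw [entryEnd_apply]
  funext Θ
  unfold entryOp
  split_ifs <;> rfl

/-- The product of the entries `(i, σ i)`, `i` in a list `l`, of `- D_Θ + c I_n`. -/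
def rowOp {n : ℕ} (c : ℝ) (σ : Fin n → Fin n) (l : List (Fin n)) : Module.End ℂ (smoothFun n) :=
  (l.map fun i => entryEnd c i (σ i)).prod

theorem rowOp_cons {n : ℕ} (c : ℝ) (σ : Fin n → Fin n) (i : Fin n) (l : List (Fin n))
    (f : smoothFun n) : rowOp c σ (i :: l) f = entryEnd c i (σ i) (rowOp c σ l f) := by
  simp [rowOp]

theorem rowOp_coe {n : ℕ} (c : ℝ) (σ : Fin n → Fin n) (l : List (Fin n)) (f : smoothFun n) :
    (rowOp c σ l f).1 = l.foldr (fun i g => entryOp c i (σ i) g) f.1 := by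
  induction l with
  | nil => rfl
  | cons i l ih => rw [rowOp_cons, entryEnd_coe, ih, List.foldr_cons]

/-- `det (- D_Θ + c I_n)` as an endomorphism of the smooth functions. -/
def detEnd {n : ℕ} (c : ℝ) : Module.End ℂ (smoothFun n) :=
  ∑ σ : Equiv.Perm (Fin n), ((Equiv.Perm.sign σ : ℤ) : ℂ) • rowOp c σ (List.finRange n)

theorem smoothFun_sum_apply {n : ℕ} {ι : Type*} (s : Finset ι) (f : ι → smoothFun n)
    (Θ : Matrix (Fin n) (Fin n) ℝ) : (∑ i ∈ s, f i).1 Θ = ∑ i ∈ s, (f i).1 Θ := by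
  change (smoothFun n).val (∑ i ∈ s, f i) Θ = _
  rw [map_sum, Finset.sum_apply]
  rfl

theorem detEnd_coe {n : ℕ} (c : ℝ) (f : smoothFun n) : (detEnd c f).1 = detOp c f.1 := by
  funext Θ
  simp only [detEnd, LinearMap.sum_apply, smoothFun_sum_apply, detOp, LinearMap.smul_apply]
  refine Finset.sum_congr rfl fun σ _ => ?_
  rw [← rowOp_coe]
  rfl

/-- Evaluation at `Θ = 0`. -/
def evalZero (n : ℕ) : smoothFun n →ₗ[ℂ] ℂ where
  toFun f := f.1 0
  map_add' _ _ := rfl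
  map_smul' _ _ := rfl

theorem evalZero_mul {n : ℕ} (f g : smoothFun n) :
    evalZero n (f * g) = evalZero n f * evalZero n g := rfl

/-- The functions all multiples of which are annihilated by `det (- D_Θ + c I_n)` at `0`. -/
def nullIdeal (n : ℕ) : Ideal (smoothFun n) where
  carrier := {f | ∀ (c : ℝ) (g : smoothFun n), evalZero n (detEnd c (f * g)) = 0}
  add_mem' hf hg c g := by rw [add_mul, map_add, map_add, hf, hg, add_zero]
  zero_mem' c g := by simp
  smul_mem' a f hf c g := by
    rw [smul_eq_mul, mul_comm a f, mul_assoc]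
    exact hf c _

/-- Permits replacing the argument of the determinantal operator by any representative modulo
`nullIdeal`. -/
theorem evalZero_detEnd_eq_of_sub_mem {n : ℕ} {f g : smoothFun n} (h : f - g ∈ nullIdeal n)
    (c : ℝ) : evalZero n (detEnd c f) = evalZero n (detEnd c g) := by
  have := h c 1
  rw [mul_one, map_sub, map_sub, sub_eq_zero] at this
  exact this

/-! ### Coordinate functions and the Leibniz rule -/

/-- The coordinate function `Θ ↦ Θ a b`. -/
def coordFun {n : ℕ} (p : Fin n × Fin n) : smoothFun n :=
  ⟨fun Θ => (Θ p.1 p.2 : ℂ), by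
    change ContDiff ℝ ∞ fun A : Fin n → Fin n → ℝ => ((A p.1 p.2 : ℝ) : ℂ)
    exact Complex.ofRealCLM.contDiff.comp (by fun_prop)⟩

/-- `(D_Θ)_{ij} θ_p`. -/
def coordCoeff {n : ℕ} (i j : Fin n) (p : Fin n × Fin n) : ℂ :=
  1 / 2 * ((if (i, j) = p then 1 else 0) + (if (j, i) = p then 1 else 0))

theorem thetaDeriv_coordFun {n : ℕ} (i j : Fin n) (p : Fin n × Fin n) :
    thetaDeriv i j (coordFun p) = algebraMap ℂ (smoothFun n) (coordCoeff i j p) := by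
  ext Θ
  rw [thetaDeriv_coe, DTheta_eq_fderiv i j (coordFun p).2]
  have h : (fun A : Fin n → Fin n → ℝ => (coordFun p).1 (Matrix.of A)) =
      (Complex.ofRealCLM.comp ((ContinuousLinearMap.proj (R := ℝ) p.2).comp
        (ContinuousLinearMap.proj (R := ℝ) p.1 : (Fin n → Fin n → ℝ) →L[ℝ] (Fin n → ℝ))))
      := rfl
  rw [h, ContinuousLinearMap.fderiv]
  change ((symDir i j p.1 p.2 : ℝ) : ℂ) = coordCoeff i j p
  obtain ⟨a, b⟩ := p
  simp only [symDir, coordCoeff, Matrix.smul_apply, Matrix.add_apply, Matrix.single_apply,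
    smul_eq_mul, Prod.mk.injEq]
  split_ifs <;> simp

theorem entryEnd_coordFun_mul {n : ℕ} (c : ℝ) (i j : Fin n) (p : Fin n × Fin n)
    (g : smoothFun n) : entryEnd c i j (coordFun p * g) =
      coordFun p * entryEnd c i j g - coordCoeff i j p • g := by
  rw [entryEnd_apply, entryEnd_apply, Derivation.leibniz, thetaDeriv_coordFun]
  split_ifs
  · simp only [smul_eq_mul, Algebra.smul_def]; ring
  · simp only [smul_eq_mul, Algebra.smul_def]; ring

/-- Each entry operator differentiates a coordinate to a constant, so moving `θ_p` to the left
through the product deletes one entry at a time. -/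
theorem rowOp_coordFun_mul {n : ℕ} (c : ℝ) (σ : Fin n → Fin n) (p : Fin n × Fin n)
    (l : List (Fin n)) (hl : l.Nodup) (g : smoothFun n) :
    rowOp c σ l (coordFun p * g) = coordFun p * rowOp c σ l g -
      ∑ i : Fin n, if i ∈ l then coordCoeff i (σ i) p • rowOp c σ (l.erase i) g else 0 := by
  induction l with
  | nil => simp [rowOp]
  | cons a l ih =>
    obtain ⟨ha, hl'⟩ := List.nodup_cons.1 hl
    rw [rowOp_cons, ih hl', map_sub, entryEnd_coordFun_mul, map_sum, sub_sub, ← rowOp_cons]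
    congr 1
    rw [Fintype.sum_eq_add_sum_compl a (fun i => if i ∈ a :: l then _ else 0),
      Fintype.sum_eq_add_sum_compl a (fun i => entryEnd c a (σ a) _)]
    simp only [List.mem_cons, true_or, if_true, List.erase_cons_head, ha, if_false, map_zero,
      zero_add]
    congr 1
    refine Finset.sum_congr rfl fun i hi => ?_
    have hia : i ≠ a := by simpa using hi
    by_cases h : i ∈ l
    · simp only [h, or_true, if_true, map_smul]
      rw [List.erase_cons_tail (by simpa using hia.symm), rowOp_cons]
    · simp [h, hia]

/-- At the origin the undifferentiated term vanishes: the factor `θ_p` has to be consumed by exactly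
one row. -/
theorem evalZero_rowOp_coordFun_mul {n : ℕ} (c : ℝ) (σ : Fin n → Fin n) (p : Fin n × Fin n)
    (l : List (Fin n)) (hl : l.Nodup) (g : smoothFun n) :
    evalZero n (rowOp c σ l (coordFun p * g)) =
      ∑ i : Fin n, if i ∈ l then
        -coordCoeff i (σ i) p * evalZero n (rowOp c σ (l.erase i) g) else 0 := by
  have h0 : evalZero n (coordFun p) = 0 := by
    change (((0 : Matrix (Fin n) (Fin n) ℝ) p.1 p.2 : ℝ) : ℂ) = 0
    simp
  rw [rowOp_coordFun_mul c σ p l hl, map_sub, evalZero_mul, h0, zero_mul, zero_sub, map_sum,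
    ← Finset.sum_neg_distrib]
  refine Finset.sum_congr rfl fun i _ => ?_
  split_ifs <;> simp

open Classical in
/-- The Leibniz rule for a product of coordinate functions, at `Θ = 0`. -/
theorem evalZero_rowOp_prod_coordFun_mul {n : ℕ} (c : ℝ) (σ : Fin n → Fin n) (k : ℕ) :
    ∀ (J : Fin k → Fin n × Fin n) (l : List (Fin n)) (_ : l.Nodup) (g : smoothFun n),
    evalZero n (rowOp c σ l ((∏ a, coordFun (J a)) * g)) =
      ∑ r : Fin k → Fin n, if Function.Injective r ∧ ∀ a, r a ∈ l then
        (∏ a, -coordCoeff (r a) (σ (r a)) (J a)) *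
          evalZero n (rowOp c σ (l.filter fun i => i ∉ Set.range r) g) else 0 := by
  induction k with
  | zero =>
    intro J l hl g
    simp [Function.injective_of_subsingleton]
  | succ k ih =>
    intro J l hl g
    rw [Fin.prod_univ_succ, mul_assoc, evalZero_rowOp_coordFun_mul c σ _ l hl,
      ← (Fin.consEquiv fun _ => Fin n).sum_comp, Fintype.sum_prod_type]
    refine Finset.sum_congr rfl fun i _ => ?_
    split_ifs with hi
    · rw [ih _ _ (hl.erase i), Finset.mul_sum]
      refine Finset.sum_congr rfl fun r _ => ?_
      -- The row `i` consumed by the first factor is erased from the list, which is what makes the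
      -- assignment of rows to factors injective.
      have hcond : (Function.Injective (Fin.cons i r : Fin (k + 1) → Fin n) ∧
          ∀ a, (Fin.cons i r : Fin (k + 1) → Fin n) a ∈ l) ↔
          (Function.Injective r ∧ ∀ a, r a ∈ l.erase i) := by
        rw [Fin.cons_injective_iff, Fin.forall_fin_succ]
        simp only [Fin.cons_zero, Fin.cons_succ, hl.mem_erase_iff, Set.mem_range, not_exists]
        constructor
        · rintro ⟨⟨h1, h2⟩, -, h4⟩
          exact ⟨h2, fun a => ⟨h1 a, h4 a⟩⟩
        · rintro ⟨h1, h2⟩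
          exact ⟨⟨fun a => (h2 a).1, h1⟩, hi, fun a => (h2 a).2⟩
      change _ = if Function.Injective (Fin.cons i r : Fin (k + 1) → Fin n) ∧
          ∀ a, (Fin.cons i r : Fin (k + 1) → Fin n) a ∈ l then
        (∏ a, -coordCoeff ((Fin.cons i r : Fin (k + 1) → Fin n) a)
          (σ ((Fin.cons i r : Fin (k + 1) → Fin n) a)) (J a)) *
          evalZero n (rowOp c σ
            (l.filter fun x => x ∉ Set.range (Fin.cons i r : Fin (k + 1) → Fin n)) g) else 0
      by_cases h : Function.Injective r ∧ ∀ a, r a ∈ l.erase i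
      · rw [if_pos h, if_pos (hcond.2 h), Fin.prod_univ_succ, mul_assoc]
        simp only [Fin.cons_zero, Fin.cons_succ]
        congr 4
        rw [hl.erase_eq_filter, List.filter_filter]
        congr 1
        refine List.filter_congr fun x _ => ?_
        rw [Bool.and_comm]
        simp [Fin.range_cons, bne, beq_eq_decide]
      · rw [if_neg h, if_neg (fun h' => h (hcond.1 h')), mul_zero]
    · refine (Finset.sum_eq_zero fun r _ => if_neg fun h => hi ?_).symm
      simpa using h.2 0

/-- Summation of a linear form against the coefficients of `(D_Θ)_{i_a j_a}`, `a = 1, …, k`. -/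
theorem sum_linear_mul_prod_coordCoeff {n k : ℕ} {R : Type*} [CommRing R] [Algebra ℂ R]
    (L : R →ₗ[ℂ] ℂ) (Y : Fin k → Fin n × Fin n → R) (hY : ∀ a i j, Y a (i, j) = Y a (j, i))
    (r s : Fin k → Fin n) :
    ∑ J : Fin k → Fin n × Fin n, L (∏ a, Y a (J a)) * ∏ a, -coordCoeff (r a) (s a) (J a) =
      (-1) ^ k * L (∏ a, Y a (r a, s a)) := by
  have h1 : ∀ a, ∑ p : Fin n × Fin n, (-coordCoeff (r a) (s a) p) • Y a p =
      (-1 : ℂ) • Y a (r a, s a) := by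
    intro a
    simp only [coordCoeff, neg_smul, Finset.sum_neg_distrib, mul_add, add_smul,
      Finset.sum_add_distrib, mul_ite, mul_one, mul_zero, ite_smul, zero_smul,
      Finset.sum_ite_eq, Finset.mem_univ, if_true]
    rw [hY a (s a) (r a), ← add_smul]
    norm_num
  have h2 : ∏ a, (-1 : ℂ) • Y a (r a, s a) = (-1 : ℂ) ^ k • ∏ a, Y a (r a, s a) := by
    rw [Finset.prod_smul, Finset.prod_const, Finset.card_univ, Fintype.card_fin]
  rw [← smul_eq_mul, ← map_smul, ← h2, ← Finset.prod_congr rfl fun a _ => h1 a,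
    Finset.prod_univ_sum, map_sum, Fintype.piFinset_univ]
  refine Finset.sum_congr rfl fun J _ => ?_
  rw [Finset.prod_smul, map_smul, smul_eq_mul, mul_comm]

theorem sign_viaFintypeEmbedding_cast {α β : Type*} [Fintype α] [Fintype β] [DecidableEq α]
    [DecidableEq β] (e : Equiv.Perm α) (f : α ↪ β) :
    ((Equiv.Perm.sign (e.viaFintypeEmbedding f) : ℤ) : ℂ) = ((Equiv.Perm.sign e : ℤ) : ℂ) := by
  rw [Equiv.Perm.viaFintypeEmbedding_sign]

/-- A permutation of the loop acts both on the factors, through `f`, and on the rows assigned to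
them, through `f.trans g`; the two actions are compatible. -/
theorem viaFintypeEmbedding_trans_apply {α β δ : Type*} [Fintype α] [DecidableEq β]
    [DecidableEq δ] (e : Equiv.Perm α) (f : α ↪ β) (g : β ↪ δ) (b : β) :
    e.viaFintypeEmbedding (f.trans g) (g b) = g (e.viaFintypeEmbedding f b) := by
  by_cases hb : b ∈ Set.range f
  · obtain ⟨a, rfl⟩ := hb
    rw [Equiv.Perm.viaFintypeEmbedding_apply_image]
    exact Equiv.Perm.viaFintypeEmbedding_apply_image e (f.trans g) a
  · rw [Equiv.Perm.viaFintypeEmbedding_apply_notMem_range _ _ hb,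
      Equiv.Perm.viaFintypeEmbedding_apply_notMem_range]
    rintro ⟨a, ha⟩
    exact hb ⟨a, g.injective ha⟩

/-- A polynomial in `Θ` whose coefficients become zero by antisymmetrization over the second
indices of some of the factors `θ_{ij}` is annihilated by the determinantal operator. -/
theorem sum_prod_coordFun_mem_nullIdeal {n k K : ℕ} {R : Type*} [CommRing R] [Algebra ℂ R]
    (L : R →ₗ[ℂ] ℂ) (Y : Fin k → Fin n × Fin n → R) (hY : ∀ a i j, Y a (i, j) = Y a (j, i))
    (e : Fin K ↪ Fin k)
    (h : ∀ r s : Fin k → Fin n, ∑ τ : Equiv.Perm (Fin K), ((Equiv.Perm.sign τ : ℤ) : ℂ) *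
      L (∏ a, Y a (r a, s (τ.viaFintypeEmbedding e a))) = 0) :
    ∑ J : Fin k → Fin n × Fin n, L (∏ a, Y a (J a)) • ∏ a, coordFun (J a) ∈ nullIdeal n := by
  classical
  intro c g
  set G : (Fin k → Fin n) → Equiv.Perm (Fin n) → ℂ := fun r σ =>
    evalZero n (rowOp c σ ((List.finRange n).filter fun i => i ∉ Set.range r) g) with hG
  -- Factor `a` is consumed by row `r a`, whose column is `σ (r a)`; the sum over `J` then contracts
  -- the coefficients to the index pairs `(r a, σ (r a))`.
  have h1 : evalZero n (detEnd c ((∑ J : Fin k → Fin n × Fin n,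
      L (∏ a, Y a (J a)) • ∏ a, coordFun (J a)) * g)) =
      ∑ r : Fin k → Fin n, if Function.Injective r then
        ∑ σ : Equiv.Perm (Fin n), ((Equiv.Perm.sign σ : ℤ) : ℂ) *
          (((-1) ^ k * L (∏ a, Y a (r a, σ (r a)))) * G r σ) else 0 := by
    rw [Finset.sum_mul, map_sum, map_sum]
    have h2 : ∀ J : Fin k → Fin n × Fin n,
        evalZero n (detEnd c ((L (∏ a, Y a (J a)) • ∏ a, coordFun (J a)) * g)) =
        ∑ r : Fin k → Fin n, if Function.Injective r then
          ∑ σ : Equiv.Perm (Fin n), ((Equiv.Perm.sign σ : ℤ) : ℂ) *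
            ((L (∏ a, Y a (J a)) * ∏ a, -coordCoeff (r a) (σ (r a)) (J a)) * G r σ) else 0 := by
      intro J
      rw [smul_mul_assoc, map_smul, map_smul, detEnd, LinearMap.sum_apply, map_sum,
        Finset.smul_sum]
      simp only [LinearMap.smul_apply, map_smul]
      rw [Finset.sum_congr rfl fun σ _ => by
        rw [evalZero_rowOp_prod_coordFun_mul c σ k J _ (List.nodup_finRange n) g]]
      simp only [List.mem_finRange, implies_true, and_true, smul_eq_mul, Finset.mul_sum]
      rw [Finset.sum_comm]
      refine Finset.sum_congr rfl fun r _ => ?_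
      split_ifs with hr
      · refine Finset.sum_congr rfl fun σ _ => ?_
        simp only [hG]
        ring
      · simp
    rw [Finset.sum_congr rfl fun J _ => h2 J, Finset.sum_comm]
    refine Finset.sum_congr rfl fun r _ => ?_
    split_ifs with hr
    · rw [Finset.sum_comm]
      refine Finset.sum_congr rfl fun σ _ => ?_
      rw [← sum_linear_mul_prod_coordCoeff L Y hY r fun a => σ (r a), ← Finset.mul_sum,
        Finset.sum_mul]
    · simp
  rw [h1]
  refine Finset.sum_eq_zero fun r _ => ?_
  split_ifs with hr
  swap
  · rfl
  set A := ∑ σ : Equiv.Perm (Fin n), ((Equiv.Perm.sign σ : ℤ) : ℂ) *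
          (((-1) ^ k * L (∏ a, Y a (r a, σ (r a)))) * G r σ) with hA
  set ι : Fin k ↪ Fin n := ⟨r, hr⟩ with hι
  -- Substitute `σ * τ` for `σ`, with `τ` acting on the rows of the selected factors. The remaining
  -- factor `G r σ` involves only rows outside the range of `r` and is unchanged.
  have h3 : ∀ τ : Equiv.Perm (Fin K), A = ∑ σ : Equiv.Perm (Fin n),
      ((Equiv.Perm.sign σ : ℤ) : ℂ) * ((-1) ^ k * G r σ) * (((Equiv.Perm.sign τ : ℤ) : ℂ) *
        L (∏ a, Y a (r a, (fun b => σ (r b)) (τ.viaFintypeEmbedding e a)))) := by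
    intro τ
    rw [hA, ← Equiv.sum_comp (Equiv.mulRight (τ.viaFintypeEmbedding (e.trans ι)))]
    refine Finset.sum_congr rfl fun σ _ => ?_
    have hs : ((Equiv.Perm.sign (σ * τ.viaFintypeEmbedding (e.trans ι)) : ℤ) : ℂ) =
        ((Equiv.Perm.sign σ : ℤ) : ℂ) * ((Equiv.Perm.sign τ : ℤ) : ℂ) := by
      rw [Equiv.Perm.sign_mul, ← sign_viaFintypeEmbedding_cast τ (e.trans ι)]
      push_cast
      rfl
    have hg : G r (σ * τ.viaFintypeEmbedding (e.trans ι)) = G r σ := by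
      simp only [hG, rowOp]
      congr 3
      refine List.map_congr_left fun i hi => ?_
      have hi' : i ∉ Set.range r := by simpa using List.of_mem_filter hi
      have : τ.viaFintypeEmbedding (e.trans ι) i = i := by
        refine Equiv.Perm.viaFintypeEmbedding_apply_notMem_range _ _ ?_
        rintro ⟨a, rfl⟩
        exact hi' ⟨e a, rfl⟩
      rw [Equiv.Perm.mul_apply, this]
    have hv : ∀ a, (σ * τ.viaFintypeEmbedding (e.trans ι)) (r a) =
        σ (r (τ.viaFintypeEmbedding e a)) := by
      intro a
      rw [Equiv.Perm.mul_apply]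
      exact congrArg σ (viaFintypeEmbedding_trans_apply τ e ι a)
    simp only [Equiv.coe_mulRight, hs, hg, hv]
    ring
  -- Adding the identities `h3` over all `τ` produces the antisymmetrized coefficients, which vanish
  -- by `h`.
  have h4 : (Fintype.card (Equiv.Perm (Fin K)) : ℂ) * A = 0 := by
    rw [← nsmul_eq_mul, ← Finset.card_univ, ← Finset.sum_const,
      Finset.sum_congr rfl fun τ _ => h3 τ, Finset.sum_comm]
    refine Finset.sum_eq_zero fun σ _ => ?_
    rw [← Finset.mul_sum, h r fun b => σ (r b), mul_zero]
  exact (mul_eq_zero.1 h4).resolve_left (by exact_mod_cast Fintype.card_ne_zero)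


/-! ### The pairing of differential operators with polynomials -/

open MvPolynomial in
/-- The value at `0` of the polynomial differential operator with symbol `P` applied to a
polynomial. -/
def pairing {α : Type*} : MvPolynomial α ℂ →ₗ[ℂ] MvPolynomial α ℂ →ₗ[ℂ] ℂ :=
  (basisMonomials α ℂ).constr ℂ fun d => (d.prod fun _ k => (k ! : ℂ)) • lcoeff ℂ d

section Pairing

open MvPolynomial

variable {α : Type*}

theorem pairing_monomial (d : α →₀ ℕ) (f : MvPolynomial α ℂ) :
    pairing (monomial d 1) f = (d.prod fun _ k => (k ! : ℂ)) * coeff d f := by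
  have h := (basisMonomials α ℂ).constr_basis ℂ
    (fun d => (d.prod fun _ k => (k ! : ℂ)) • lcoeff ℂ d) d
  rw [coe_basisMonomials] at h
  rw [pairing, h]
  rfl

theorem pairing_one (f : MvPolynomial α ℂ) : pairing 1 f = constantCoeff f := by
  have : (1 : MvPolynomial α ℂ) = monomial 0 1 := rfl
  rw [this, pairing_monomial]
  simp [constantCoeff_eq]

/-- Multiplication by a variable in the symbol is adjoint to differentiation; all later computations
with `pairing` rest on this. -/
theorem pairing_X_mul (e : α) (P f : MvPolynomial α ℂ) :
    pairing (X e * P) f = pairing P (pderiv e f) := by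
  classical
  induction P using MvPolynomial.induction_on' with
  | add P P' h h' => rw [mul_add, map_add, map_add, LinearMap.add_apply, LinearMap.add_apply, h, h']
  | monomial d c =>
  have hc : monomial d c = c • (monomial d 1 : MvPolynomial α ℂ) := by
    rw [smul_monomial, smul_eq_mul, mul_one]
  rw [hc, mul_smul_comm, map_smul, map_smul, LinearMap.smul_apply, LinearMap.smul_apply,
    mul_comm, X, monomial_mul, mul_one, pairing_monomial, pairing_monomial, coeff_pderiv]
  have h : ((d + Finsupp.single e 1).prod fun _ k => (k ! : ℂ)) =
      (d.prod fun _ k => (k ! : ℂ)) * (d e + 1) := by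
    rw [← Finsupp.mul_prod_erase' (d + Finsupp.single e 1) e _ (by simp),
      ← Finsupp.mul_prod_erase' d e _ (by simp), Finsupp.erase_add, Finsupp.erase_single, add_zero]
    simp [Nat.factorial_succ]
    ring
  rw [h]
  congr 1
  ring

/-- The product of a multiset of variables. -/
def varProd (m : Multiset α) : MvPolynomial α ℂ := (m.map X).prod

theorem varProd_cons (e : α) (m : Multiset α) : varProd (e ::ₘ m) = X e * varProd m := by
  simp [varProd]

theorem varProd_add (m m' : Multiset α) : varProd (m + m') = varProd m * varProd m' := by
  simp [varProd]

theorem prod_X_eq_varProd {ι : Type*} (s : Finset ι) (x : ι → α) :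
    ∏ i ∈ s, (X (x i) : MvPolynomial α ℂ) = varProd (s.val.map x) := by
  rw [varProd, Multiset.map_map]
  rfl

/-- The ideal of the polynomials vanishing at the origin. -/
def originIdeal (α : Type*) : Ideal (MvPolynomial α ℂ) :=
  RingHom.ker (constantCoeff : MvPolynomial α ℂ →+* ℂ)

theorem pderiv_mem_originIdeal_pow (e : α) (r : ℕ) :
    ∀ f ∈ originIdeal α ^ (r + 1), pderiv e f ∈ originIdeal α ^ r := by
  induction r with
  | zero => intro f _; simp
  | succ r ih =>
    intro f hf
    rw [pow_succ'] at hf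
    refine Submodule.mul_induction_on hf (fun a ha b hb => ?_) (fun a b ha hb => ?_)
    · rw [Derivation.leibniz, smul_eq_mul, smul_eq_mul]
      refine add_mem ?_ (Ideal.mul_mem_right _ _ hb)
      rw [pow_succ']
      exact Ideal.mul_mem_mul ha (ih b hb)
    · rw [map_add]
      exact add_mem ha hb

/-- Each derivative lowers the order of vanishing by at most one, so an operator of order below `r`
gives zero at the origin. -/
theorem pairing_varProd_eq_zero (m : Multiset α) :
    ∀ (r : ℕ) (f : MvPolynomial α ℂ), f ∈ originIdeal α ^ r → Multiset.card m < r →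
      pairing (varProd m) f = 0 := by
  induction m using Multiset.induction with
  | empty =>
    intro r f hf hr
    have : varProd (0 : Multiset α) = 1 := by simp [varProd]
    rw [this, pairing_one]
    exact Ideal.pow_le_self (by simp at hr; omega) hf
  | cons e m ih =>
    intro r f hf hr
    obtain ⟨r, rfl⟩ : ∃ s, r = s + 1 := ⟨r - 1, by omega⟩
    rw [varProd_cons, pairing_X_mul]
    exact ih r _ (pderiv_mem_originIdeal_pow e r f hf) (by simpa using hr)

/-- When the order of the operator equals the order of vanishing of `f`, every derivative must fall
on `f`, and only the value of `h` at the origin remains. -/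
theorem pairing_varProd_mul (m : Multiset α) :
    ∀ (f h : MvPolynomial α ℂ), f ∈ originIdeal α ^ Multiset.card m →
      pairing (varProd m) (f * h) = pairing (varProd m) f * constantCoeff h := by
  induction m using Multiset.induction with
  | empty =>
    intro f h _
    have : varProd (0 : Multiset α) = 1 := by simp [varProd]
    rw [this, pairing_one, pairing_one, map_mul]
  | cons e m ih =>
    intro f h hf
    rw [Multiset.card_cons] at hf
    rw [varProd_cons, pairing_X_mul, pairing_X_mul, Derivation.leibniz, map_add, smul_eq_mul,
      smul_eq_mul, pairing_varProd_eq_zero m _ (f * pderiv e h) (Ideal.mul_mem_right _ _ hf)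
        (Nat.lt_succ_self _), mul_comm h, ih _ _ (pderiv_mem_originIdeal_pow e _ f hf), zero_add]

/-- Derivatives in variables absent from `f` fall entirely on `h`, uniformly in the remaining symbol
`P`. This separates the points off the loop. -/
theorem exists_pairing_mul_varProd (m : Multiset α) (f : MvPolynomial α ℂ)
    (hm : ∀ e ∈ m, pderiv e f = 0) :
    ∀ h : MvPolynomial α ℂ, ∃ h', ∀ P, pairing (P * varProd m) (f * h) = pairing P (f * h') := by
  induction m using Multiset.induction with
  | empty => exact fun h => ⟨h, fun P => by simp [varProd]⟩
  | cons e m ih =>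
    intro h
    obtain ⟨h', hh'⟩ := ih (fun e' he' => hm e' (Multiset.mem_cons_of_mem he')) (pderiv e h)
    refine ⟨h', fun P => ?_⟩
    rw [varProd_cons, mul_left_comm, pairing_X_mul, Derivation.leibniz,
      hm e (Multiset.mem_cons_self _ _), smul_zero, add_zero, smul_eq_mul, hh']

/-- The determinant of the partial derivatives `∂/∂x_{k j}` annihilates a function invariant under
simultaneous translation in the first index. -/
theorem pairing_det_mul_eq_zero {K : ℕ} (hK : 0 < K) {β : Type*} (x : Fin K → β → α)
    (s : Fin K → β) (P f : MvPolynomial α ℂ) (hf : ∀ j, ∑ k, pderiv (x k j) f = 0) :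
    pairing ((Matrix.of fun k k' => (X (x k (s k')) : MvPolynomial α ℂ)).det * P) f = 0 := by
  set A : Matrix (Fin K) (Fin K) (MvPolynomial α ℂ) :=
    Matrix.of fun k k' => (X (x k (s k')) : MvPolynomial α ℂ) with hA
  -- Replacing row `0` by the sum of all rows leaves the determinant unchanged. Expanding along that
  -- row puts the factors `∑ k, ∂/∂x_{kj}` in front, and these kill `f`.
  have h1 := Matrix.det_updateRow_sum A ⟨0, hK⟩ fun _ => 1
  rw [one_smul] at h1
  rw [← h1, Matrix.det_eq_sum_mul_adjugate_row _ ⟨0, hK⟩, Finset.sum_mul, map_sum,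
    LinearMap.sum_apply]
  refine Finset.sum_eq_zero fun k' _ => ?_
  rw [Matrix.updateRow_self, Finset.sum_apply, Finset.sum_mul, Finset.sum_mul, map_sum,
    LinearMap.sum_apply]
  simp only [one_smul, hA, Matrix.of_apply, mul_assoc, pairing_X_mul]
  rw [← map_sum, hf, map_zero]

/-- The sum of partial derivatives is a derivation, so it kills a product as soon as it kills each
factor. -/
theorem sum_pderiv_prod_eq_zero {ι κ : Type*} [Fintype κ] (x : κ → α) (s : Finset ι)
    (f : ι → MvPolynomial α ℂ) (hf : ∀ i ∈ s, ∑ k, pderiv (x k) (f i) = 0) :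
    ∑ k, pderiv (x k) (∏ i ∈ s, f i) = 0 := by
  refine Finset.prod_induction f (fun g => ∑ k, pderiv (x k) g = 0) (fun a b ha hb => ?_)
    (by simp) hf
  simp only [Derivation.leibniz, Finset.sum_add_distrib, ← Finset.smul_sum, ha, hb, smul_zero,
    add_zero]

end Pairing

/-! ### Half squared distances and loops -/

section Loops

open MvPolynomial

variable {N n : ℕ}

/-- The polynomial `‖t_a - t_b‖² / 2`. -/
def edgePoly (n : ℕ) {N : ℕ} (p : Pair N) : MvPolynomial (Fin N × Fin n) ℂ :=
  ∑ i, C (1 / 2) * (X (p.1.1, i) - X (p.1.2, i)) ^ 2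

theorem pderiv_edgePoly (p : Pair N) (b : Fin N) (i : Fin n) :
    pderiv (b, i) (edgePoly n p) = (X (p.1.1, i) - X (p.1.2, i)) *
      ((if p.1.1 = b then 1 else 0) - (if p.1.2 = b then 1 else 0)) := by
  have h : ∀ a : Fin N, ∀ j : Fin n, pderiv (b, i) (X (a, j) : MvPolynomial (Fin N × Fin n) ℂ) =
      if j = i then (if a = b then 1 else 0) else 0 := by
    intro a j
    rw [pderiv_X, Pi.single_apply]
    by_cases h1 : a = b <;> by_cases h2 : j = i <;> simp [h1, h2]
  have h2 : (C (1 / 2) : MvPolynomial (Fin N × Fin n) ℂ) * 2 = 1 := by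
    rw [show (2 : MvPolynomial (Fin N × Fin n) ℂ) = C 2 from rfl, ← C_mul]
    norm_num
  rw [edgePoly, map_sum, Finset.sum_eq_single i]
  · rw [pderiv_C_mul, pderiv_pow, map_sub, h, h]
    simp only [if_true, Nat.cast_ofNat, Nat.add_one_sub_one, pow_one]
    linear_combination (X (p.1.1, i) - X (p.1.2, i)) *
      ((if p.1.1 = b then 1 else 0) - (if p.1.2 = b then 1 else 0)) * h2
  · intro j _ hj
    rw [pderiv_C_mul, pderiv_pow, map_sub, h, h]
    simp [hj]
  · simp

theorem edgePoly_mem_originIdeal (p : Pair N) :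
    edgePoly n p ∈ originIdeal (Fin N × Fin n) ^ 2 := by
  refine sum_mem fun i _ => Ideal.mul_mem_left _ _ (Ideal.pow_mem_pow ?_ 2)
  simp [originIdeal, RingHom.mem_ker]

theorem prod_edgePoly_mem_originIdeal {ι : Type*} (s : Finset ι) (G : ι → Pair N) :
    ∏ i ∈ s, edgePoly n (G i) ∈ originIdeal (Fin N × Fin n) ^ (2 * s.card) := by
  have := Ideal.prod_mem_prod (s := s) (I := fun _ => originIdeal (Fin N × Fin n) ^ 2)
    (x := fun i => edgePoly n (G i)) fun i _ => edgePoly_mem_originIdeal (G i)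
  rwa [Finset.prod_const, ← pow_mul] at this

/-- The edges `E 0, …, E (K - 1)` form a loop through the distinct points `p 0, …, p (K - 1)`. -/
structure IsCycle {K : ℕ} (p : Fin K → Fin N) (E : Fin K → Pair N) : Prop where
  inj : Function.Injective p
  edge : ∀ k, s((E k).1.1, (E k).1.2) = s(p k, p (finRotate K k))

theorem IsCycle.ends {K : ℕ} {p : Fin K → Fin N} {E : Fin K → Pair N} (h : IsCycle p E)
    (k : Fin K) : (∃ a, p a = (E k).1.1) ∧ ∃ a, p a = (E k).1.2 := by
  have := h.edge k
  rw [Sym2.eq_iff] at this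
  rcases this with ⟨h1, h2⟩ | ⟨h1, h2⟩
  · exact ⟨⟨_, h1.symm⟩, ⟨_, h2.symm⟩⟩
  · exact ⟨⟨_, h1.symm⟩, ⟨_, h2.symm⟩⟩

theorem IsCycle.pderiv_eq_zero {K : ℕ} {p : Fin K → Fin N} {E : Fin K → Pair N}
    (h : IsCycle p E) (e : Fin N × Fin n) (he : e.1 ∉ Set.range p) :
    pderiv e (∏ k, edgePoly n (E k)) = 0 := by
  have := sum_pderiv_prod_eq_zero (κ := Unit) (fun _ => e) Finset.univ
    (fun k => edgePoly n (E k)) fun k _ => by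
      obtain ⟨⟨a, ha⟩, ⟨b, hb⟩⟩ := h.ends k
      have h1 : (E k).1.1 ≠ e.1 := fun h' => he ⟨a, ha.trans h'⟩
      have h2 : (E k).1.2 ≠ e.1 := fun h' => he ⟨b, hb.trans h'⟩
      obtain ⟨e1, e2⟩ := e
      simp only at h1 h2
      simp [pderiv_edgePoly, h1, h2]
  simpa using this

/-- Both ends of every edge lie on the loop, so translating all loop points together leaves the edge
polynomials invariant. -/
theorem IsCycle.sum_pderiv_eq_zero {K : ℕ} {p : Fin K → Fin N} {E : Fin K → Pair N}
    (h : IsCycle p E) (j : Fin n) :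
    ∑ k, pderiv (p k, j) (∏ k, edgePoly n (E k)) = 0 := by
  refine sum_pderiv_prod_eq_zero (fun k => (p k, j)) _ _ fun k _ => ?_
  obtain ⟨⟨a, ha⟩, ⟨b, hb⟩⟩ := h.ends k
  simp only [pderiv_edgePoly, ← Finset.mul_sum, Finset.sum_sub_distrib, ← ha, ← hb,
    h.inj.eq_iff, Finset.sum_ite_eq, Finset.mem_univ, if_true, sub_self, mul_zero]

/-- If a differential operator acts fewer than `2 K` times on the points of a loop of length `K`,
then it does not contribute. -/
theorem IsCycle.pairing_eq_zero_of_card_lt {K : ℕ} {p : Fin K → Fin N} {E : Fin K → Pair N}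
    (hc : IsCycle p E) (h : MvPolynomial (Fin N × Fin n) ℂ) (m m' : Multiset (Fin N × Fin n))
    (hm : Multiset.card m < 2 * K) (hm' : ∀ e ∈ m', e.1 ∉ Set.range p) :
    pairing (varProd m * varProd m') ((∏ k, edgePoly n (E k)) * h) = 0 := by
  obtain ⟨h', hh'⟩ := exists_pairing_mul_varProd m' (∏ k, edgePoly n (E k))
    (fun e he => hc.pderiv_eq_zero e (hm' e he)) h
  rw [hh']
  refine pairing_varProd_eq_zero m (2 * K) _ (Ideal.mul_mem_right _ _ ?_) hm
  simpa using prod_edgePoly_mem_originIdeal (n := n) Finset.univ E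

/-- The loop cancellation. -/
theorem IsCycle.sum_sign_mul_pairing_eq_zero {K : ℕ} (hK : 0 < K) {p : Fin K → Fin N}
    {E : Fin K → Pair N} (hc : IsCycle p E) (h : MvPolynomial (Fin N × Fin n) ℂ)
    (r s : Fin K → Fin n) (m' : Multiset (Fin N × Fin n)) (hm' : ∀ e ∈ m', e.1 ∉ Set.range p) :
    ∑ τ : Equiv.Perm (Fin K), ((Equiv.Perm.sign τ : ℤ) : ℂ) *
      pairing ((∏ k, X (p k, s (τ k))) * (∏ k, X (p k, r k)) * varProd m')
        ((∏ k, edgePoly n (E k)) * h) = 0 := by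
  obtain ⟨h', hh'⟩ := exists_pairing_mul_varProd m' (∏ k, edgePoly n (E k))
    (fun e he => hc.pderiv_eq_zero e (hm' e he)) h
  -- The loop product vanishes to order `2 * K` and the two products of variables supply exactly `2
  -- * K` derivatives, so everything else contributes only the constant `constantCoeff h'`, which
  -- does not depend on `τ`.
  have h1 : ∀ τ : Equiv.Perm (Fin K), pairing
      ((∏ k, X (p k, s (τ k))) * (∏ k, X (p k, r k)) * varProd m')
      ((∏ k, edgePoly n (E k)) * h) =
      pairing ((∏ k, X (p k, s (τ k))) * (∏ k, X (p k, r k))) (∏ k, edgePoly n (E k)) *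
        constantCoeff h' := by
    intro τ
    rw [hh', prod_X_eq_varProd, prod_X_eq_varProd, ← varProd_add]
    refine pairing_varProd_mul _ _ _ ?_
    have := prod_edgePoly_mem_originIdeal (n := n) Finset.univ E
    simpa [two_mul] using this
  have h2 := pairing_det_mul_eq_zero hK (fun k j => (p k, j)) s (∏ k, X (p k, r k))
    (∏ k, edgePoly n (E k)) fun j => hc.sum_pderiv_eq_zero j
  rw [← Matrix.det_transpose, Matrix.det_apply', Finset.sum_mul, map_sum,
    LinearMap.sum_apply] at h2
  rw [← zero_mul (constantCoeff h'), ← h2, Finset.sum_mul]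
  refine Finset.sum_congr rfl fun τ _ => ?_
  rw [h1, ← mul_assoc]
  congr 1
  have : (((Equiv.Perm.sign τ : ℤ) : MvPolynomial (Fin N × Fin n) ℂ)) =
      C ((Equiv.Perm.sign τ : ℤ) : ℂ) := by simp
  rw [this, mul_assoc, ← smul_eq_C_mul, map_smul, LinearMap.smul_apply, smul_eq_mul]
  rfl

end Loops


/-! ### Cancellation of diagrams with loops -/

section LoopCancellation

open MvPolynomial

variable {N n : ℕ}

/-- The edge labels `l` are distinct, so the loop edges form a subproduct; parallel edges count as
separate factors even though their endpoints coincide. -/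
theorem exists_isCycle_of_hasLoop {M K : ℕ} (G : Fin M → Pair N)
    (h : Diagram.HasLoop ⟨N, M, G⟩ K) :
    ∃ (p : Fin K → Fin N) (E : Fin K → Pair N) (H : MvPolynomial (Fin N × Fin n) ℂ),
      IsCycle p E ∧ ∏ m, edgePoly n (G m) = (∏ k, edgePoly n (E k)) * H := by
  classical
  obtain ⟨p, l, hp, hl, hedge⟩ := h
  refine ⟨p, fun k => G (l k), ∏ m ∈ (Finset.univ.image l)ᶜ, edgePoly n (G m), ⟨hp, hedge⟩, ?_⟩
  rw [← Finset.prod_mul_prod_compl (Finset.univ.image l), Finset.prod_image hl.injOn]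

/-- The monomial `∏_b ∂/∂t_b^{I_b} ∏_c ∂²/∂t_c^{i_c} ∂t_c^{j_c}`, `J_c = (i_c, j_c)`. -/
def jetSymbol {v w : ℕ} (gv : Fin v → Fin N) (hv : Fin w → Fin N) (I : Fin v → Fin n)
    (J : Fin w → Fin n × Fin n) : MvPolynomial (Fin N × Fin n) ℂ :=
  (∏ b, X (gv b, I b)) * ∏ c, X (hv c, (J c).1) * X (hv c, (J c).2)

/-- A loop through a point which does not carry a second derivative does not contribute. -/
theorem pairing_jetSymbol_eq_zero {v w K : ℕ} {gv : Fin v → Fin N} {hv : Fin w → Fin N}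
    (hgv : Function.Injective gv) (hhv : Function.Injective hv) (hd : ∀ b c, gv b ≠ hv c)
    {p : Fin K → Fin N} {E : Fin K → Pair N} (hc : IsCycle p E) (k0 : Fin K)
    (hk0 : p k0 ∉ Set.range hv) (H : MvPolynomial (Fin N × Fin n) ℂ) (I : Fin v → Fin n)
    (J : Fin w → Fin n × Fin n) :
    pairing (jetSymbol gv hv I J) ((∏ k, edgePoly n (E k)) * H) = 0 := by
  classical
  set S : Finset (Fin v) := {b | gv b ∈ Set.range p} with hS
  set T : Finset (Fin w) := {c | hv c ∈ Set.range p} with hT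
  -- `S` and `T` collect the loop points carrying gradients and Hessians. They are disjoint, so
  -- `S.card + T.card ≤ K`, and `p k0` is not in `T`, so `T.card ≤ K - 1`.
  have hcard : S.card + 2 * T.card < 2 * K := by
    have h1 : (S.image gv ∪ T.image hv).card ≤ (Finset.univ.image p).card := by
      refine Finset.card_le_card fun x hx => ?_
      simp only [hS, hT, Finset.mem_union, Finset.mem_image, Finset.mem_filter, Finset.mem_univ,
        true_and, Set.mem_range] at hx ⊢
      rcases hx with ⟨b, hb, rfl⟩ | ⟨b, hb, rfl⟩ <;> exact hb
    have h2 : (T.image hv).card ≤ ((Finset.univ.image p).erase (p k0)).card := by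
      refine Finset.card_le_card fun x hx => ?_
      simp only [hT, Finset.mem_image, Finset.mem_filter, Finset.mem_univ, true_and,
        Finset.mem_erase, Set.mem_range] at hx ⊢
      obtain ⟨b, hb, rfl⟩ := hx
      exact ⟨fun h => hk0 ⟨b, h⟩, hb⟩
    rw [Finset.card_union_of_disjoint, Finset.card_image_of_injective _ hgv,
      Finset.card_image_of_injective _ hhv, Finset.card_image_of_injective _ hc.inj] at h1
    · rw [Finset.card_erase_of_mem (by simp), Finset.card_image_of_injective _ hhv,
        Finset.card_image_of_injective _ hc.inj] at h2
      have := k0.2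
      simp only [Finset.card_univ, Fintype.card_fin] at h1 h2
      omega
    · rw [Finset.disjoint_left]
      intro x hx hx'
      obtain ⟨b, -, rfl⟩ := Finset.mem_image.1 hx
      obtain ⟨c, -, h⟩ := Finset.mem_image.1 hx'
      exact hd b c h.symm
  have hsplit : jetSymbol gv hv I J =
      varProd (S.val.map (fun b => (gv b, I b)) + (T.val.map (fun c => (hv c, (J c).1)) +
        T.val.map (fun c => (hv c, (J c).2)))) *
      varProd (Sᶜ.val.map (fun b => (gv b, I b)) + (Tᶜ.val.map (fun c => (hv c, (J c).1)) +
        Tᶜ.val.map (fun c => (hv c, (J c).2)))) := by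
    simp only [varProd_add, ← prod_X_eq_varProd, jetSymbol, Finset.prod_mul_distrib]
    rw [← Finset.prod_mul_prod_compl S, ← Finset.prod_mul_prod_compl T,
      ← Finset.prod_mul_prod_compl T (fun c => X (hv c, (J c).2))]
    ring
  rw [hsplit]
  refine hc.pairing_eq_zero_of_card_lt H _ _ ?_ ?_
  · simp only [Multiset.card_add, Multiset.card_map, Finset.card_val]
    omega
  · intro e he
    simp only [Multiset.mem_add, Multiset.mem_map, Finset.mem_val, Finset.mem_compl, hS, hT,
      Finset.mem_filter, Finset.mem_univ, true_and] at he
    rcases he with ⟨b, hb, rfl⟩ | ⟨b, hb, rfl⟩ | ⟨b, hb, rfl⟩ <;> exact hb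

/-- A loop all of whose points carry second derivatives does not contribute after
antisymmetrization. -/
theorem sum_sign_mul_pairing_jetSymbol_eq_zero {v w K : ℕ} (hK : 0 < K) {gv : Fin v → Fin N}
    {hv : Fin w → Fin N} (hhv : Function.Injective hv) (hd : ∀ b c, gv b ≠ hv c)
    {p : Fin K → Fin N} {E : Fin K → Pair N} (hc : IsCycle p E) (e : Fin K ↪ Fin w)
    (he : ∀ k, p k = hv (e k)) (H : MvPolynomial (Fin N × Fin n) ℂ) (I : Fin v → Fin n)
    (r s : Fin w → Fin n) :
    ∑ τ : Equiv.Perm (Fin K), ((Equiv.Perm.sign τ : ℤ) : ℂ) *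
      pairing (jetSymbol gv hv I fun c => (r c, s (τ.viaFintypeEmbedding e c)))
        ((∏ k, edgePoly n (E k)) * H) = 0 := by
  classical
  set T : Finset (Fin w) := Finset.univ.image e with hT
  have hnot : ∀ c ∈ Tᶜ, hv c ∉ Set.range p := by
    rintro c hcT ⟨k, hk⟩
    rw [he] at hk
    refine Finset.mem_compl.1 hcT (Finset.mem_image.2 ⟨k, Finset.mem_univ _, hhv hk⟩)
  have hnotg : ∀ b, gv b ∉ Set.range p := by
    rintro b ⟨k, hk⟩
    rw [he] at hk
    exact hd b _ hk.symm
  set m' : Multiset (Fin N × Fin n) := Finset.univ.val.map (fun b => (gv b, I b)) +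
    (Tᶜ.val.map (fun c => (hv c, r c)) + Tᶜ.val.map (fun c => (hv c, s c))) with hm'
  have key := hc.sum_sign_mul_pairing_eq_zero hK H (fun k => r (e k)) (fun k => s (e k)) m' (by
    intro x hx
    simp only [hm', Multiset.mem_add, Multiset.mem_map, Finset.mem_val, Finset.mem_univ,
      true_and] at hx
    rcases hx with ⟨b, rfl⟩ | ⟨b, hb, rfl⟩ | ⟨b, hb, rfl⟩
    · exact hnotg b
    · exact hnot b hb
    · exact hnot b hb)
  rw [← key]
  refine Finset.sum_congr rfl fun τ _ => ?_
  congr 3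
  have h1 : ∀ c ∈ Tᶜ, s (τ.viaFintypeEmbedding e c) = s c := by
    intro c hcT
    rw [Equiv.Perm.viaFintypeEmbedding_apply_notMem_range]
    rintro ⟨k, rfl⟩
    exact Finset.mem_compl.1 hcT (Finset.mem_image.2 ⟨k, Finset.mem_univ _, rfl⟩)
  have h2 : ∏ c ∈ Tᶜ, (X (hv c, s (τ.viaFintypeEmbedding e c)) : MvPolynomial (Fin N × Fin n) ℂ) =
      ∏ c ∈ Tᶜ, X (hv c, s c) := Finset.prod_congr rfl fun c hcT => by rw [h1 c hcT]
  simp only [hm', varProd_add, ← prod_X_eq_varProd, jetSymbol, Finset.prod_mul_distrib]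
  rw [← Finset.prod_mul_prod_compl T,
    ← Finset.prod_mul_prod_compl T (fun c => X (hv c, s (τ.viaFintypeEmbedding e c))),
    h2, hT, Finset.prod_image e.injective.injOn, Finset.prod_image e.injective.injOn]
  simp only [Equiv.Perm.viaFintypeEmbedding_apply_image, ← he]
  ring

/-- The polynomial in `Θ` multiplying a derivative whose diagram has a loop is annihilated by the
determinantal operator. -/
theorem sum_pairing_jetSymbol_mem_nullIdeal {v w M K : ℕ} {gv : Fin v → Fin N}
    {hv : Fin w → Fin N} (hgv : Function.Injective gv) (hhv : Function.Injective hv)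
    (hd : ∀ b c, gv b ≠ hv c) (G : Fin M → Pair N) (hK : 2 ≤ K)
    (hG : Diagram.HasLoop ⟨N, M, G⟩ K) (I : Fin v → Fin n) :
    ∑ J : Fin w → Fin n × Fin n, pairing (jetSymbol gv hv I J) (∏ m, edgePoly n (G m)) •
      ∏ c, coordFun (J c) ∈ nullIdeal n := by
  classical
  obtain ⟨p, E, H, hc, hprod⟩ := exists_isCycle_of_hasLoop (n := n) G hG
  rw [hprod]
  set L : MvPolynomial (Fin N × Fin n) ℂ →ₗ[ℂ] ℂ :=
    (pairing.flip ((∏ k, edgePoly n (E k)) * H)).comp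
      (LinearMap.mulLeft ℂ (∏ b, X (gv b, I b))) with hL
  set Y : Fin w → Fin n × Fin n → MvPolynomial (Fin N × Fin n) ℂ :=
    fun c q => X (hv c, q.1) * X (hv c, q.2) with hY
  have hYs : ∀ c i j, Y c (i, j) = Y c (j, i) := fun c i j => mul_comm _ _
  have hLY : ∀ J, L (∏ c, Y c (J c)) =
    pairing (jetSymbol gv hv I J) ((∏ k, edgePoly n (E k)) * H) := fun J => rfl
  -- If every loop point carries a Hessian, antisymmetrization gives zero; otherwise each
  -- coefficient is already zero by counting derivatives.
  by_cases hp : ∀ k, ∃ c, hv c = p k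
  · choose e he using hp
    have he' : Function.Injective e := fun a b hab => hc.inj (by rw [← he, ← he, hab])
    refine sum_prod_coordFun_mem_nullIdeal L Y hYs ⟨e, he'⟩ fun r s => ?_
    simp only [hLY]
    exact sum_sign_mul_pairing_jetSymbol_eq_zero (by omega) hhv hd hc ⟨e, he'⟩
      (fun k => (he k).symm) H I r s
  · push Not at hp
    obtain ⟨k0, hk0⟩ := hp
    convert (nullIdeal n).zero_mem
    refine Finset.sum_eq_zero fun J _ => ?_
    rw [pairing_jetSymbol_eq_zero hgv hhv hd hc k0 (by rintro ⟨c, h⟩; exact hk0 c h), zero_smul]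

end LoopCancellation


/-! ### Symmetry of higher derivatives -/

section Symmetry

variable {E F : Type*} [NormedAddCommGroup E] [NormedSpace ℝ E] [NormedAddCommGroup F]
  [NormedSpace ℝ F]

theorem contDiff_infty_differentiableAt_iteratedFDeriv {f : E → F} (hf : ContDiff ℝ ∞ f) (d : ℕ)
    (x : E) : DifferentiableAt ℝ (iteratedFDeriv ℝ d f) x :=
  hf.contDiffAt.differentiableAt_iteratedFDeriv (by exact_mod_cast WithTop.coe_lt_top d)

theorem iteratedFDeriv_succ_apply_eq {f : E → F} (hf : ContDiff ℝ ∞ f) (d : ℕ) (x : E)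
    (m : Fin (d + 1) → E) : iteratedFDeriv ℝ (d + 1) f x m =
      fderiv ℝ (fun y => iteratedFDeriv ℝ d f y (Fin.tail m)) x (m 0) :=
  (contDiff_infty_differentiableAt_iteratedFDeriv hf d x).iteratedFDeriv_succ_apply_left'

/-- The transposition of the two outermost slots is symmetry of a second derivative; the other
neighbouring transpositions act under one outer derivative and follow by induction. -/
theorem iteratedFDeriv_comp_swap {f : E → F} (hf : ContDiff ℝ ∞ f) (d : ℕ) :
    ∀ (i : Fin d) (x : E) (m : Fin (d + 1) → E),
      iteratedFDeriv ℝ (d + 1) f x (m ∘ Equiv.swap i.castSucc i.succ) =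
        iteratedFDeriv ℝ (d + 1) f x m := by
  induction d with
  | zero => exact fun i => i.elim0
  | succ d ih =>
    intro i x m
    refine Fin.cases ?_ (fun j => ?_) i
    · have hg : ContDiff ℝ ∞ (iteratedFDeriv ℝ d f) :=
        hf.iteratedFDeriv_right (by exact_mod_cast le_top)
      have h2 : ContDiff ℝ ∞ (fderiv ℝ (iteratedFDeriv ℝ d f)) := hg.fderiv_right (by simp)
      have key : ∀ m : Fin (d + 2) → E, iteratedFDeriv ℝ (d + 2) f x m =
          fderiv ℝ (fderiv ℝ (iteratedFDeriv ℝ d f)) x (m 0) (m 1) (Fin.tail (Fin.tail m)) := by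
        intro m
        rw [iteratedFDeriv_succ_apply_eq hf]
        simp only [iteratedFDeriv_succ_apply_left]
        have hd := h2.differentiable (by simp) x
        have h3 : DifferentiableAt ℝ
            (fun y => fderiv ℝ (iteratedFDeriv ℝ d f) y (Fin.tail m 0)) x :=
          hd.clm_apply (differentiableAt_const _)
        rw [fderiv_continuousMultilinear_apply_const h3,
          fderiv_clm_apply hd (differentiableAt_const _)]
        simp
        rfl
      have hs : IsSymmSndFDerivAt ℝ (iteratedFDeriv ℝ d f) x :=
        hg.contDiffAt.isSymmSndFDerivAt (by
        rw [minSmoothness_of_isRCLikeNormedField]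
        exact WithTop.coe_le_coe.2 (le_top : (2 : ℕ∞) ≤ ⊤))
      rw [key, key]
      have e0 : (m ∘ Equiv.swap (Fin.castSucc 0) (Fin.succ 0)) 0 = m 1 := by simp
      have e1 : (m ∘ Equiv.swap (Fin.castSucc 0) (Fin.succ 0)) 1 = m 0 := by simp
      have e2 : Fin.tail (Fin.tail (m ∘ Equiv.swap (Fin.castSucc 0) (Fin.succ 0))) =
          Fin.tail (Fin.tail m) := by
        funext k
        simp only [Fin.tail, Function.comp_apply]
        rw [Equiv.swap_apply_of_ne_of_ne]
        · simp
        · simp [Fin.ext_iff]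
      rw [e0, e1, e2, hs.eq]
    · rw [iteratedFDeriv_succ_apply_eq hf, iteratedFDeriv_succ_apply_eq hf]
      have e0 : (m ∘ Equiv.swap j.succ.castSucc j.succ.succ) 0 = m 0 := by
        simp only [Function.comp_apply]
        rw [Equiv.swap_apply_of_ne_of_ne] <;> simp [Fin.ext_iff]
      have e1 : Fin.tail (m ∘ Equiv.swap j.succ.castSucc j.succ.succ) =
          Fin.tail m ∘ Equiv.swap j.castSucc j.succ := by
        funext k
        simp only [Fin.tail, Function.comp_apply]
        congr 1
        rw [Fin.castSucc_succ]
        exact ((Fin.succ_injective (d + 1)).swap_apply _ _ _)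
      rw [e0, e1]
      simp only [ih]

/-- Higher derivatives of a smooth function are symmetric. -/
theorem iteratedFDeriv_comp_perm_of_contDiff {f : E → F} (hf : ContDiff ℝ ∞ f) (d : ℕ) (x : E)
    (m : Fin d → E) (τ : Equiv.Perm (Fin d)) :
    iteratedFDeriv ℝ d f x (m ∘ τ) = iteratedFDeriv ℝ d f x m := by
  cases d with
  | zero => rw [Subsingleton.elim (m ∘ τ) m]
  | succ d =>
    have hτ : τ ∈ Submonoid.closure
        (Set.range fun i : Fin d => Equiv.swap i.castSucc i.succ) := by
      rw [Equiv.Perm.mclosure_swap_castSucc_succ]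
      trivial
    induction hτ using Submonoid.closure_induction generalizing m with
    | mem τ h =>
      obtain ⟨i, rfl⟩ := h
      exact iteratedFDeriv_comp_swap hf d i x m
    | one => rfl
    | mul σ τ _ _ h1 h2 =>
      have : m ∘ ⇑(σ * τ) = (m ∘ σ) ∘ τ := rfl
      rw [this, h2, h1]

/-- Derivatives at the origin of the composition with a map homogeneous of degree `2`. -/
theorem iteratedFDeriv_comp_quadratic {V : Type*} [NormedAddCommGroup V] [NormedSpace ℝ V]
    {q : E → V} (hq : ContDiff ℝ ∞ q) (hq2 : ∀ (c : ℝ) t, q (c • t) = c ^ 2 • q t) (d : ℕ)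
    {k k' : V → F} (hk : ContDiff ℝ ∞ k) (hk' : ContDiff ℝ ∞ k')
    (h : ∀ M, d = 2 * M → iteratedFDeriv ℝ M k 0 = iteratedFDeriv ℝ M k' 0) :
    iteratedFDeriv ℝ d (k ∘ q) 0 = iteratedFDeriv ℝ d (k' ∘ q) 0 := by
  have hq0 : q 0 = 0 := by simpa using hq2 0 0
  -- Differentiating `q (2 t) = 4 q t` at the origin `j` times gives `2 ^ j` on one side and `4` on
  -- the other.
  have hjet : ∀ j, j ≠ 2 → iteratedFDeriv ℝ j q 0 = 0 := by
    intro j hj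
    have hqj : ContDiff ℝ j q := hq.of_le (by exact_mod_cast le_top)
    have h1 := congrFun (iteratedFDeriv_comp_const_smul (𝕜 := ℝ) (2 : ℝ) hqj) 0
    have h2 : iteratedFDeriv ℝ j (fun z => q ((2 : ℝ) • z)) 0 =
        (2 : ℝ) ^ 2 • iteratedFDeriv ℝ j q 0 := by
      simp only [hq2]
      exact iteratedFDeriv_const_smul_apply' hqj.contDiffAt
    rw [h2, smul_zero] at h1
    have h3 : ((2 : ℝ) ^ 2 - 2 ^ j) • iteratedFDeriv ℝ j q 0 = 0 := by
      rw [sub_smul, h1, sub_self]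
    refine (smul_eq_zero.1 h3).resolve_left fun h4 => hj ?_
    have h5 : (2 : ℝ) ^ 2 = 2 ^ j := sub_eq_zero.1 h4
    exact (Nat.pow_right_injective le_rfl (by exact_mod_cast h5)).symm
  have hle : (d : WithTop ℕ∞) ≤ ∞ := by exact_mod_cast le_top
  rw [iteratedFDeriv_comp hk.contDiffAt hq.contDiffAt hle,
    iteratedFDeriv_comp hk'.contDiffAt hq.contDiffAt hle, hq0]
  unfold FormalMultilinearSeries.taylorComp
  refine Finset.sum_congr rfl fun c _ => ?_
  ext m
  simp only [FormalMultilinearSeries.compAlongOrderedFinpartition_apply]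
  -- In the Faà di Bruno sum only partitions into blocks of size `2` survive; they have `d / 2`
  -- blocks and involve only the derivative of that order.
  by_cases hc : ∀ i, c.partSize i = 2
  · have hd : d = 2 * c.length := by
      have := Fintype.card_congr c.equivSigma
      simp only [Fintype.card_sigma, Fintype.card_fin, hc, Finset.sum_const, Finset.card_univ,
        smul_eq_mul] at this
      omega
    exact congrArg (fun L : ContinuousMultilinearMap ℝ (fun _ : Fin c.length => V) F => L _)
      (h _ hd)
  · push Not at hc
    obtain ⟨i, hi⟩ := hc
    have hz : (c.applyOrderedFinpartition fun i => ftaylorSeries ℝ q 0 (c.partSize i)) m i = 0 := by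
      rw [OrderedFinpartition.applyOrderedFinpartition_apply]
      change iteratedFDeriv ℝ (c.partSize i) q 0 _ = 0
      rw [hjet _ hi]
      rfl
    rw [ContinuousMultilinearMap.map_coord_zero _ i hz,
      ContinuousMultilinearMap.map_coord_zero _ i hz]

/-- The `d`-th derivative at the origin of the homogeneous Taylor polynomial of degree `d`. -/
theorem iteratedFDeriv_homogeneous_taylor {f : E → F} (hf : ContDiff ℝ ∞ f) (d : ℕ) :
    iteratedFDeriv ℝ d (fun x => ((d ! : ℝ)⁻¹) • iteratedFDeriv ℝ d f 0 fun _ => x) 0 =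
      iteratedFDeriv ℝ d f 0 := by
  have h : ContDiff ℝ d fun x => iteratedFDeriv ℝ d f 0 fun _ => x :=
    (iteratedFDeriv ℝ d f 0).contDiff.comp (contDiff_pi.2 fun _ => contDiff_id)
  rw [iteratedFDeriv_const_smul_apply' h.contDiffAt]
  ext m
  rw [smul_apply,
    ContinuousMultilinearMap.iteratedFDeriv_comp_diagonal]
  have : ∀ τ : Equiv.Perm (Fin d), (iteratedFDeriv ℝ d f 0 fun i => m (τ i)) =
      iteratedFDeriv ℝ d f 0 m := iteratedFDeriv_comp_perm_of_contDiff hf d 0 m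
  rw [Finset.sum_congr rfl fun τ _ => this τ, Finset.sum_const, Finset.card_univ,
    Fintype.card_perm, Fintype.card_fin, ← Nat.cast_smul_eq_nsmul ℝ, smul_smul,
    inv_mul_cancel₀ (by exact_mod_cast d.factorial_ne_zero), one_smul]

end Symmetry


/-! ### The cumulants in terms of the derivatives of the point functions -/

section Jets

variable {N n : ℕ}

theorem contDiff_halfSqDist :
    ContDiff ℝ ∞ (halfSqDist : (Fin N → Fin n → ℝ) → Pair N → ℝ) := by
  refine contDiff_pi.2 fun p => ?_
  unfold halfSqDist
  fun_prop

theorem halfSqDist_smul (c : ℝ) (t : Fin N → Fin n → ℝ) :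
    halfSqDist (c • t) = c ^ 2 • halfSqDist t := by
  funext p
  simp only [halfSqDist, Pi.smul_apply, smul_eq_mul, Finset.mul_sum]
  refine Finset.sum_congr rfl fun i _ => ?_
  ring

/-- An operator which on smooth functions is a combination, with constant coefficients, of
derivatives of order `d`. -/
def IsJetOp (d : ℕ) (L : ((Fin N → Fin n → ℝ) → ℂ) → (Fin N → Fin n → ℝ) → ℂ) : Prop :=
  ∃ (ι : Type) (_ : Fintype ι) (c : ι → ℂ) (e : ι → Fin d → Fin N → Fin n → ℝ),
    ∀ f, ContDiff ℝ ∞ f → ∀ t, L f t = ∑ i, c i * iteratedFDeriv ℝ d f t (e i)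

theorem isJetOp_id : IsJetOp (N := N) (n := n) 0 fun f => f :=
  ⟨Unit, inferInstance, fun _ => 1, fun _ k => k.elim0, fun f _ t => by simp⟩

theorem IsJetOp.congr {d d' : ℕ} {L : ((Fin N → Fin n → ℝ) → ℂ) → (Fin N → Fin n → ℝ) → ℂ}
    (h : IsJetOp d L) (hd : d = d') : IsJetOp d' L := hd ▸ h

theorem IsJetOp.partialT {d : ℕ} {L : ((Fin N → Fin n → ℝ) → ℂ) → (Fin N → Fin n → ℝ) → ℂ}
    (h : IsJetOp d L) (a : Fin N) (i : Fin n) :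
    IsJetOp (d + 1) fun f => partialT a i (L f) := by
  obtain ⟨ι, hι, c, e, he⟩ := h
  refine ⟨ι, hι, c, fun k => Fin.cons (Pi.single a (Pi.single i 1)) (e k), fun f hf t => ?_⟩
  have h1 : L f = fun t => ∑ k, c k * iteratedFDeriv ℝ d f t (e k) := funext (he f hf)
  have h2 : ∀ k, DifferentiableAt ℝ (fun t => iteratedFDeriv ℝ d f t (e k)) t := fun k =>
    (contDiff_infty_differentiableAt_iteratedFDeriv hf d t).continuousMultilinear_apply_const _
  change fderiv ℝ (L f) t _ = _
  rw [h1, fderiv_fun_sum fun k _ => (h2 k).const_mul (c k), sum_apply]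
  refine Finset.sum_congr rfl fun k _ => ?_
  rw [fderiv_const_mul (h2 k), iteratedFDeriv_succ_apply_eq hf]
  rfl

theorem IsJetOp.sum_mul {d : ℕ} {ι : Type} [Fintype ι]
    {L : ι → ((Fin N → Fin n → ℝ) → ℂ) → (Fin N → Fin n → ℝ) → ℂ}
    (h : ∀ i, IsJetOp d (L i)) (a : ι → ℂ) :
    IsJetOp d fun f t => ∑ i, a i * L i f t := by
  choose κ hκ c e he using h
  refine ⟨Σ i, κ i, inferInstance, fun p => a p.1 * c p.1 p.2, fun p => e p.1 p.2,
    fun f hf t => ?_⟩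
  rw [Fintype.sum_sigma]
  refine Finset.sum_congr rfl fun i _ => ?_
  rw [he i f hf t, Finset.mul_sum]
  simp only [mul_assoc]

theorem IsJetOp.gradOp {d : ℕ} {L : ((Fin N → Fin n → ℝ) → ℂ) → (Fin N → Fin n → ℝ) → ℂ}
    (h : IsJetOp d L) (T : Fin n → ℂ) (b : Fin N) :
    IsJetOp (d + 1) fun f => gradOp T b (L f) :=
  IsJetOp.sum_mul (fun i => h.partialT b i) T

theorem IsJetOp.hessOp {d : ℕ} {L : ((Fin N → Fin n → ℝ) → ℂ) → (Fin N → Fin n → ℝ) → ℂ}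
    (h : IsJetOp d L) (Θ : Matrix (Fin n) (Fin n) ℝ) (c : Fin N) :
    IsJetOp (d + 2) fun f => hessOp Θ c (L f) := by
  have := IsJetOp.sum_mul (fun i => IsJetOp.sum_mul (fun j => (h.partialT c j).partialT c i)
    fun j => (Θ i j : ℂ)) fun _ : Fin n => 1
  simp only [one_mul] at this
  exact this

theorem IsJetOp.foldr_gradOp {d : ℕ}
    {L : ((Fin N → Fin n → ℝ) → ℂ) → (Fin N → Fin n → ℝ) → ℂ} (h : IsJetOp d L)
    (T : Fin n → ℂ) {β : Type} (g : β → Fin N) (l : List β) :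
    IsJetOp (d + l.length) fun f => l.foldr (fun b f => ECDensity.gradOp T (g b) f) (L f) := by
  induction l with
  | nil => exact h
  | cons b l ih => exact ih.gradOp T (g b)

theorem IsJetOp.foldr_hessOp {d : ℕ}
    {L : ((Fin N → Fin n → ℝ) → ℂ) → (Fin N → Fin n → ℝ) → ℂ} (h : IsJetOp d L)
    (Θ : Matrix (Fin n) (Fin n) ℝ) {β : Type} (g : β → Fin N) (l : List β) :
    IsJetOp (d + 2 * l.length) fun f =>
      l.foldr (fun b f => ECDensity.hessOp Θ (g b) f) (L f) := by
  induction l with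
  | nil => exact h
  | cons b l ih => exact (ih.hessOp Θ (g b)).congr (by simp; ring)

/-- Allows the point function composed with `halfSqDist` to be replaced by a polynomial with the
same derivative of order `d` at the origin. -/
theorem IsJetOp.eq_of_jet_eq {d : ℕ}
    {L : ((Fin N → Fin n → ℝ) → ℂ) → (Fin N → Fin n → ℝ) → ℂ} (h : IsJetOp d L)
    {f g : (Fin N → Fin n → ℝ) → ℂ} (hf : ContDiff ℝ ∞ f) (hg : ContDiff ℝ ∞ g)
    (hfg : iteratedFDeriv ℝ d f 0 = iteratedFDeriv ℝ d g 0) : L f 0 = L g 0 := by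
  obtain ⟨ι, hι, c, e, he⟩ := h
  rw [he f hf, he g hg, hfg]

end Jets

/-! ### Symbols of the operators and the diagram expansion of the cumulants -/

section Symbols

open MvPolynomial

variable {N n : ℕ}

/-- The polynomial function on configurations defined by a polynomial. -/
def evalFun (F : MvPolynomial (Fin N × Fin n) ℂ) : (Fin N → Fin n → ℝ) → ℂ :=
  fun t => eval (fun v => (t v.1 v.2 : ℂ)) F

theorem hasFDerivAt_coord (v : Fin N × Fin n) (t : Fin N → Fin n → ℝ) :
    HasFDerivAt (fun t : Fin N → Fin n → ℝ => (t v.1 v.2 : ℂ))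
      (Complex.ofRealCLM.comp ((ContinuousLinearMap.proj (R := ℝ) v.2).comp
        (ContinuousLinearMap.proj (R := ℝ) v.1 : (Fin N → Fin n → ℝ) →L[ℝ] (Fin n → ℝ)))) t :=
  ContinuousLinearMap.hasFDerivAt (Complex.ofRealCLM.comp
    ((ContinuousLinearMap.proj (R := ℝ) v.2).comp
      (ContinuousLinearMap.proj (R := ℝ) v.1 : (Fin N → Fin n → ℝ) →L[ℝ] (Fin n → ℝ))))

theorem contDiff_evalFun (F : MvPolynomial (Fin N × Fin n) ℂ) : ContDiff ℝ ∞ (evalFun F) := by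
  induction F using MvPolynomial.induction_on with
  | C a =>
    have h : evalFun (C a : MvPolynomial (Fin N × Fin n) ℂ) = fun _ => a := by
      funext t; simp [evalFun]
    rw [h]
    exact contDiff_const
  | add p q hp hq =>
    have h : evalFun (p + q) = fun t => evalFun p t + evalFun q t := by
      funext t; simp [evalFun]
    rw [h]
    exact hp.add hq
  | mul_X p v hp =>
    have : ContDiff ℝ ∞ fun t : Fin N → Fin n → ℝ => (t v.1 v.2 : ℂ) :=
      Complex.ofRealCLM.contDiff.comp (by fun_prop)
    have h : evalFun (p * X v) = fun t => evalFun p t * (t v.1 v.2 : ℂ) := by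
      funext t; simp [evalFun]
    rw [h]
    exact hp.mul this

theorem partialT_evalFun (a : Fin N) (i : Fin n) (F : MvPolynomial (Fin N × Fin n) ℂ) :
    partialT a i (evalFun F) = evalFun (pderiv (a, i) F) := by
  funext t
  induction F using MvPolynomial.induction_on with
  | C c =>
    have h : evalFun (C c : MvPolynomial (Fin N × Fin n) ℂ) = fun _ => c := by
      funext t; simp [evalFun]
    simp [partialT, h, evalFun]
  | add p q hp hq =>
    have hp' := (contDiff_evalFun p).differentiable (by simp) t
    have hq' := (contDiff_evalFun q).differentiable (by simp) t
    have h : evalFun (p + q) = evalFun p + evalFun q := by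
      funext t; simp [evalFun]
    simp only [partialT] at hp hq ⊢
    rw [h, fderiv_add hp' hq', add_apply, hp, hq]
    simp [evalFun]
  | mul_X p v hp =>
    have hp' := (contDiff_evalFun p).differentiable (by simp) t
    have h : evalFun (p * X v) = evalFun p * fun t => (t v.1 v.2 : ℂ) := by
      funext t; simp [evalFun]
    simp only [partialT] at hp ⊢
    rw [h, fderiv_mul hp' (hasFDerivAt_coord v t).differentiableAt,
      (hasFDerivAt_coord v t).fderiv]
    simp only [add_apply, smul_apply, smul_eq_mul]
    rw [hp, Derivation.leibniz, pderiv_X]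
    have : (Complex.ofRealCLM.comp ((ContinuousLinearMap.proj (R := ℝ) v.2).comp
        (ContinuousLinearMap.proj (R := ℝ) v.1 : (Fin N → Fin n → ℝ) →L[ℝ] (Fin n → ℝ))))
        (Pi.single a (Pi.single i 1)) = if v = (a, i) then 1 else 0 := by
      change (((Pi.single a (Pi.single i 1) : Fin N → Fin n → ℝ) v.1 v.2 : ℝ) : ℂ) = _
      obtain ⟨v1, v2⟩ := v
      by_cases h1 : v1 = a
      · subst h1
        by_cases h2 : v2 = i <;> simp [h2]
      · simp [h1]
    rw [this]
    simp only [evalFun, smul_eq_mul, map_add, map_mul, eval_X, Pi.single_apply]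
    by_cases hv : v = (a, i)
    · simp [hv]
    · simp [hv]

/-- The symbol of `⟨T, ∇_{t_b}⟩`. -/
def gradSymbol (T : Fin n → ℂ) (b : Fin N) : MvPolynomial (Fin N × Fin n) ℂ :=
  ∑ i, C (T i) * X (b, i)

/-- The symbol of `tr(Θ ∇²_{t_c})`. -/
def hessSymbol (Θ : Matrix (Fin n) (Fin n) ℝ) (c : Fin N) : MvPolynomial (Fin N × Fin n) ℂ :=
  ∑ p : Fin n × Fin n, C (Θ p.1 p.2 : ℂ) * (X (c, p.1) * X (c, p.2))

/-- Stated with an arbitrary `P` so that the symbols of successive operators can be accumulated in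
`exists_foldr_evalFun`. -/
theorem exists_gradOp_evalFun (T : Fin n → ℂ) (b : Fin N) (F : MvPolynomial (Fin N × Fin n) ℂ) :
    ∃ G, gradOp T b (evalFun F) = evalFun G ∧
      ∀ P, pairing P G = pairing (gradSymbol T b * P) F := by
  refine ⟨∑ i, C (T i) * pderiv (b, i) F, ?_, fun P => ?_⟩
  · funext t
    simp [gradOp, partialT_evalFun, evalFun]
  · rw [gradSymbol, Finset.sum_mul, map_sum, map_sum, LinearMap.sum_apply]
    refine Finset.sum_congr rfl fun i _ => ?_
    rw [← smul_eq_C_mul, ← smul_eq_C_mul, map_smul, smul_mul_assoc, map_smul,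
      LinearMap.smul_apply, pairing_X_mul]

theorem exists_hessOp_evalFun (Θ : Matrix (Fin n) (Fin n) ℝ) (c : Fin N)
    (F : MvPolynomial (Fin N × Fin n) ℂ) :
    ∃ G, hessOp Θ c (evalFun F) = evalFun G ∧
      ∀ P, pairing P G = pairing (hessSymbol Θ c * P) F := by
  refine ⟨∑ p : Fin n × Fin n, C (Θ p.1 p.2 : ℂ) * pderiv (c, p.1) (pderiv (c, p.2) F), ?_,
    fun P => ?_⟩
  · funext t
    simp [hessOp, partialT_evalFun, evalFun, Fintype.sum_prod_type]
  · rw [hessSymbol, Finset.sum_mul, map_sum, map_sum, LinearMap.sum_apply]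
    refine Finset.sum_congr rfl fun p _ => ?_
    rw [← smul_eq_C_mul, ← smul_eq_C_mul, map_smul, smul_mul_assoc, map_smul,
      LinearMap.smul_apply, mul_comm (X (c, p.1)), mul_assoc, pairing_X_mul, pairing_X_mul]

theorem exists_foldr_evalFun {β : Type} (op : β → ((Fin N → Fin n → ℝ) → ℂ) →
      (Fin N → Fin n → ℝ) → ℂ) (sym : β → MvPolynomial (Fin N × Fin n) ℂ)
    (h : ∀ b F, ∃ G, op b (evalFun F) = evalFun G ∧ ∀ P, pairing P G = pairing (sym b * P) F)
    (l : List β) (F : MvPolynomial (Fin N × Fin n) ℂ) :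
    ∃ G, l.foldr (fun b f => op b f) (evalFun F) = evalFun G ∧
      ∀ P, pairing P G = pairing ((l.map sym).prod * P) F := by
  induction l with
  | nil => exact ⟨F, rfl, fun P => by simp⟩
  | cons b l ih =>
    obtain ⟨G, hG, hP⟩ := ih
    obtain ⟨G', hG', hP'⟩ := h b G
    refine ⟨G', by rw [List.foldr_cons, hG, hG'], fun P => ?_⟩
    rw [hP', hP, List.map_cons, List.prod_cons]
    ring_nf

theorem prod_gradSymbol_mul_prod_hessSymbol {v w : ℕ} (gv : Fin v → Fin N) (hv : Fin w → Fin N)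
    (T : Fin n → ℂ) (Θ : Matrix (Fin n) (Fin n) ℝ) :
    (∏ b, gradSymbol T (gv b)) * ∏ c, hessSymbol Θ (hv c) =
      ∑ I : Fin v → Fin n, ∑ J : Fin w → Fin n × Fin n,
        ((∏ b, T (I b)) * ∏ c, (Θ (J c).1 (J c).2 : ℂ)) • jetSymbol gv hv I J := by
  simp only [gradSymbol, hessSymbol]
  rw [Finset.prod_univ_sum, Finset.prod_univ_sum, Fintype.piFinset_univ, Fintype.piFinset_univ,
    Finset.sum_mul_sum]
  refine Finset.sum_congr rfl fun I _ => Finset.sum_congr rfl fun J _ => ?_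
  rw [Finset.prod_mul_distrib, Finset.prod_mul_distrib, ← map_prod, ← map_prod, jetSymbol,
    smul_eq_C_mul, C_mul]
  ring

/-- The part of degree `M` of the Taylor expansion of `κ N`, composed with `halfSqDist`. -/
def taylorPoly (κ : PointFunctions) (N n M : ℕ) : MvPolynomial (Fin N × Fin n) ℂ :=
  ∑ G : Fin M → Pair N,
    ((M ! : ℂ)⁻¹ * (Diagram.derivative ⟨N, M, G⟩ κ : ℂ)) • ∏ m, edgePoly n (G m)

theorem eval_edgePoly (p : Pair N) (t : Fin N → Fin n → ℝ) :
    evalFun (edgePoly n p) t = (halfSqDist t p : ℂ) := by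
  simp [evalFun, edgePoly, halfSqDist, Finset.mul_sum]

theorem iteratedFDeriv_ofReal_comp {V : Type*} [NormedAddCommGroup V] [NormedSpace ℝ V]
    {k : V → ℝ} (hk : ContDiff ℝ ∞ k) (M : ℕ) (x : V) (m : Fin M → V) :
    iteratedFDeriv ℝ M (fun x => (k x : ℂ)) x m = (iteratedFDeriv ℝ M k x m : ℂ) := by
  have := Complex.ofRealCLM.iteratedFDeriv_comp_left (x := x) (i := M) hk.contDiffAt
    (by exact_mod_cast le_top)
  exact congrArg (fun L : ContinuousMultilinearMap ℝ (fun _ : Fin M => V) ℂ => L m) this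

theorem contDiff_ofReal_comp {V : Type*} [NormedAddCommGroup V] [NormedSpace ℝ V]
    {k : V → ℝ} (hk : ContDiff ℝ ∞ k) : ContDiff ℝ ∞ fun x => (k x : ℂ) :=
  Complex.ofRealCLM.contDiff.comp hk

theorem evalFun_taylorPoly {κ : PointFunctions} (hκ : ContDiff ℝ ∞ (κ N)) (M : ℕ) :
    evalFun (taylorPoly κ N n M) = (fun x : Pair N → ℝ =>
      ((M ! : ℝ)⁻¹) • iteratedFDeriv ℝ M (fun x => (κ N x : ℂ)) 0 fun _ => x) ∘ halfSqDist := by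
  classical
  funext t
  have h1 : (fun _ : Fin M => halfSqDist t) =
      fun _ : Fin M => ∑ p, halfSqDist t p • (Pi.single p 1 : Pair N → ℝ) := by
    funext _ p
    simp [Finset.sum_apply, Pi.single_apply]
  have h2 : evalFun (taylorPoly κ N n M) t = ∑ G : Fin M → Pair N,
      ((M ! : ℂ)⁻¹ * (Diagram.derivative ⟨N, M, G⟩ κ : ℂ)) * ∏ m, (halfSqDist t (G m) : ℂ) := by
    have : ∀ G : Fin M → Pair N, eval (fun v => (t v.1 v.2 : ℂ)) (∏ m, edgePoly n (G m)) =
        ∏ m, (halfSqDist t (G m) : ℂ) := by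
      intro G
      rw [map_prod]
      exact Finset.prod_congr rfl fun m _ => eval_edgePoly (G m) t
    simp only [evalFun, taylorPoly, map_sum, smul_eval, this]
  rw [h2, Function.comp_apply, h1, ContinuousMultilinearMap.map_sum, Finset.smul_sum]
  refine Finset.sum_congr rfl fun G _ => ?_
  rw [ContinuousMultilinearMap.map_smul_univ, iteratedFDeriv_ofReal_comp hκ]
  simp only [Diagram.derivative, Complex.real_smul]
  push_cast
  ring

/-- Only the `M`-th derivative of `κ N` enters, and the homogeneous Taylor polynomial of degree `M`
has the same one. -/
theorem iteratedFDeriv_comp_halfSqDist {κ : PointFunctions} (hκ : ContDiff ℝ ∞ (κ N)) (M : ℕ) :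
    iteratedFDeriv ℝ (2 * M) (fun t : Fin N → Fin n → ℝ => (κ N (halfSqDist t) : ℂ)) 0 =
      iteratedFDeriv ℝ (2 * M) (evalFun (taylorPoly κ N n M)) 0 := by
  rw [evalFun_taylorPoly hκ]
  have hk := contDiff_ofReal_comp hκ
  refine iteratedFDeriv_comp_quadratic contDiff_halfSqDist halfSqDist_smul (2 * M)
    (k := fun x => (κ N x : ℂ)) hk ?_ fun M' hM' => ?_
  · exact ((iteratedFDeriv ℝ M (fun x => (κ N x : ℂ)) 0).contDiff.comp
      (contDiff_pi.2 fun _ => contDiff_id)).const_smul _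
  · obtain rfl : M = M' := by omega
    exact (iteratedFDeriv_homogeneous_taylor hk M).symm

theorem iteratedFDeriv_comp_halfSqDist_of_odd {κ : PointFunctions} (hκ : ContDiff ℝ ∞ (κ N))
    {d : ℕ} (hd : ∀ M, d ≠ 2 * M) :
    iteratedFDeriv ℝ d (fun t : Fin N → Fin n → ℝ => (κ N (halfSqDist t) : ℂ)) 0 =
      iteratedFDeriv ℝ d (evalFun (0 : MvPolynomial (Fin N × Fin n) ℂ)) 0 := by
  have h0 : evalFun (0 : MvPolynomial (Fin N × Fin n) ℂ) = (fun _ => 0) ∘ halfSqDist := by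
    funext t
    simp [evalFun]
  rw [h0]
  exact iteratedFDeriv_comp_quadratic contDiff_halfSqDist halfSqDist_smul d
    (k := fun x => (κ N x : ℂ)) (contDiff_ofReal_comp hκ) contDiff_const
    fun M hM => absurd hM (hd M)

theorem cumulantK_eq_pairing {κ : PointFunctions} {u v w : ℕ}
    (hκ : ContDiff ℝ ∞ (κ (u + v + w))) (s : ℂ) (T : Fin n → ℂ) (Θ : Matrix (Fin n) (Fin n) ℝ)
    (F : MvPolynomial (Fin (u + v + w) × Fin n) ℂ)
    (hF : iteratedFDeriv ℝ (2 * w + v)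
      (fun t : Fin (u + v + w) → Fin n → ℝ => (κ (u + v + w) (halfSqDist t) : ℂ)) 0 =
      iteratedFDeriv ℝ (2 * w + v) (evalFun F) 0) :
    cumulantK κ u v w s T Θ = s ^ u * ∑ I : Fin v → Fin n, ∑ J : Fin w → Fin n × Fin n,
      ((∏ b, T (I b)) * ∏ c, (Θ (J c).1 (J c).2 : ℂ)) *
        pairing (jetSymbol (fun b => Fin.castAdd w (Fin.natAdd u b))
          (fun c => Fin.natAdd (u + v) c) I J) F := by
  have h1 : IsJetOp (2 * w + v) fun f : (Fin (u + v + w) → Fin n → ℝ) → ℂ =>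
      (List.finRange v).foldr (fun b g => gradOp T (Fin.castAdd w (Fin.natAdd u b)) g)
      ((List.finRange w).foldr (fun c g => hessOp Θ (Fin.natAdd (u + v) c) g) f) :=
    ((isJetOp_id.foldr_hessOp Θ (fun c => Fin.natAdd (u + v) c) (List.finRange w)).foldr_gradOp
      T (fun b => Fin.castAdd w (Fin.natAdd u b)) (List.finRange v)).congr (by simp)
  have h2 := h1.eq_of_jet_eq (contDiff_ofReal_comp (hκ.comp contDiff_halfSqDist))
    (contDiff_evalFun F) hF
  obtain ⟨G, hG, hGP⟩ := exists_foldr_evalFun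
    (fun c g => hessOp Θ (Fin.natAdd (u + v) c) g) _
    (fun c F => exists_hessOp_evalFun Θ (Fin.natAdd (u + v) c) F) (List.finRange w) F
  obtain ⟨G', hG', hGP'⟩ := exists_foldr_evalFun
    (fun b g => gradOp T (Fin.castAdd w (Fin.natAdd u b)) g) _
    (fun b F => exists_gradOp_evalFun T (Fin.castAdd w (Fin.natAdd u b)) F) (List.finRange v) G
  rw [cumulantK]
  congr 1
  refine h2.trans ?_
  rw [hG, hG']
  have h3 : evalFun G' 0 = pairing 1 G' := by
    rw [pairing_one, constantCoeff_eq, ← constantCoeff_eq, ← eval_zero', evalFun]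
    congr 2
  rw [h3, hGP', hGP, mul_one, ← Fin.prod_univ_def, ← Fin.prod_univ_def, mul_comm,
    prod_gradSymbol_mul_prod_hessSymbol, map_sum, LinearMap.sum_apply]
  refine Finset.sum_congr rfl fun I _ => ?_
  rw [map_sum, LinearMap.sum_apply]
  refine Finset.sum_congr rfl fun J _ => ?_
  rw [map_smul, LinearMap.smul_apply, smul_eq_mul]

theorem cumulantK_eq_zero {κ : PointFunctions} {u v w : ℕ}
    (hκ : ContDiff ℝ ∞ (κ (u + v + w))) (s : ℂ) (T : Fin n → ℂ) (Θ : Matrix (Fin n) (Fin n) ℝ)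
    (hM : ∀ M, 2 * w + v ≠ 2 * M) : cumulantK κ u v w s T Θ = 0 := by
  rw [cumulantK_eq_pairing hκ s T Θ 0 (iteratedFDeriv_comp_halfSqDist_of_odd hκ hM)]
  simp

/-- The coefficient of the derivative with diagram `G` in `K_{u,v,w}`, for given indices `I` of
the first derivatives. -/
def diagramPoly {u v w M : ℕ} (G : Fin M → Pair (u + v + w)) (I : Fin v → Fin n) :
    smoothFun n :=
  ∑ J : Fin w → Fin n × Fin n, pairing (jetSymbol (fun b => Fin.castAdd w (Fin.natAdd u b))
    (fun c => Fin.natAdd (u + v) c) I J) (∏ m, edgePoly n (G m)) • ∏ c, coordFun (J c)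

theorem smoothFun_prod_apply {ι : Type*} (s : Finset ι) (f : ι → smoothFun n)
    (Θ : Matrix (Fin n) (Fin n) ℝ) : (∏ i ∈ s, f i).1 Θ = ∏ i ∈ s, (f i).1 Θ := by
  change (smoothFun n).val (∏ i ∈ s, f i) Θ = _
  rw [map_prod, Finset.prod_apply]
  rfl

theorem diagramPoly_apply {u v w M : ℕ} (G : Fin M → Pair (u + v + w)) (I : Fin v → Fin n)
    (Θ : Matrix (Fin n) (Fin n) ℝ) : (diagramPoly G I).1 Θ =
      ∑ J : Fin w → Fin n × Fin n, pairing (jetSymbol (fun b => Fin.castAdd w (Fin.natAdd u b))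
        (fun c => Fin.natAdd (u + v) c) I J) (∏ m, edgePoly n (G m)) *
          ∏ c, (Θ (J c).1 (J c).2 : ℂ) := by
  rw [diagramPoly, smoothFun_sum_apply]
  refine Finset.sum_congr rfl fun J _ => ?_
  change _ * (∏ c, coordFun (J c)).1 Θ = _
  rw [smoothFun_prod_apply]
  rfl

theorem diagramPoly_mem_nullIdeal {u v w M K : ℕ} (G : Fin M → Pair (u + v + w)) (hK : 2 ≤ K)
    (hG : Diagram.HasLoop ⟨u + v + w, M, G⟩ K) (I : Fin v → Fin n) :
    diagramPoly G I ∈ nullIdeal n := by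
  refine sum_pairing_jetSymbol_mem_nullIdeal (fun b b' h => ?_) (fun c c' h => ?_)
    (fun b c h => ?_) G hK hG I
  · simpa using h
  · simpa using h
  · have := congrArg Fin.val h
    simp at this
    omega

/-- The diagram expansion: it separates the derivatives of the point function, the variables `T`,
and the polynomials in `Θ`. -/
theorem cumulantK_eq {κ : PointFunctions} {u v w M : ℕ}
    (hκ : ContDiff ℝ ∞ (κ (u + v + w))) (s : ℂ) (T : Fin n → ℂ) (Θ : Matrix (Fin n) (Fin n) ℝ)
    (hM : 2 * w + v = 2 * M) :
    cumulantK κ u v w s T Θ = s ^ u * ∑ G : Fin M → Pair (u + v + w), ∑ I : Fin v → Fin n,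
      (M ! : ℂ)⁻¹ * (Diagram.derivative ⟨u + v + w, M, G⟩ κ : ℂ) * (∏ b, T (I b)) *
        (diagramPoly G I).1 Θ := by
  rw [cumulantK_eq_pairing hκ s T Θ (taylorPoly κ (u + v + w) n M)
    (by rw [hM]; exact iteratedFDeriv_comp_halfSqDist hκ M)]
  congr 1
  refine Eq.trans ?_ Finset.sum_comm
  refine Finset.sum_congr rfl fun I _ => ?_
  simp only [taylorPoly, map_sum, map_smul, diagramPoly_apply, Finset.mul_sum, smul_eq_mul]
  rw [Finset.sum_comm]
  refine Finset.sum_congr rfl fun G _ => Finset.sum_congr rfl fun J _ => ?_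
  ring

end Symbols


/-! ### Families of point functions and polynomials in loopless derivatives -/

/-- The families of point functions of the theorem. -/
def Family : Type :=
  {κ : PointFunctions // (∀ N, ContDiff ℝ ∞ (κ N)) ∧ rho κ 0 = 1 ∧ 0 < gamma κ}

/-- No loop of length at least `2`. -/
def Diagram.Loopless (D : Diagram) : Prop := ∀ K, 2 ≤ K → ¬ D.HasLoop K

/-- The value of a variable: `γ^{-1/2}` or a derivative at the origin. -/
def varValue (κ : PointFunctions) (d : Option Diagram) : ℝ :=
  d.elim (1 / Real.sqrt (gamma κ)) fun D => D.derivative κ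

/-- The real polynomials in `γ^{-1/2}` and the derivatives with loopless diagrams. -/
def goodAlg : Subalgebra ℝ (Family → ℂ) :=
  Algebra.adjoin ℝ {c | ∃ d : Option Diagram, (∀ D, d = some D → D.Loopless) ∧
    c = fun κ => (varValue κ.1 d : ℂ)}

theorem exists_polynomial_of_mem_goodAlg {c : Family → ℂ} (hc : c ∈ goodAlg) :
    ∃ P : MvPolynomial (Option Diagram) ℝ,
      (∀ κ : Family, c κ = ((MvPolynomial.eval (varValue κ.1) P : ℝ) : ℂ)) ∧
      ∀ D, some D ∈ P.vars → D.Loopless := by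
  classical
  induction hc using Algebra.adjoin_induction with
  | mem c h =>
    obtain ⟨d, hd, rfl⟩ := h
    refine ⟨MvPolynomial.X d, fun κ => by simp, fun D hD => hd D ?_⟩
    rw [MvPolynomial.vars_X] at hD
    exact (Finset.mem_singleton.1 hD).symm
  | algebraMap r =>
    exact ⟨MvPolynomial.C r, fun κ => by simp, fun D hD => by simp at hD⟩
  | add c c' _ _ h h' =>
    obtain ⟨P, hP, hP'⟩ := h
    obtain ⟨Q, hQ, hQ'⟩ := h'
    refine ⟨P + Q, fun κ => by simp [hP, hQ], fun D hD => ?_⟩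
    rcases Finset.mem_union.1 (MvPolynomial.vars_add_subset P Q hD) with h | h
    · exact hP' D h
    · exact hQ' D h
  | mul c c' _ _ h h' =>
    obtain ⟨P, hP, hP'⟩ := h
    obtain ⟨Q, hQ, hQ'⟩ := h'
    refine ⟨P * Q, fun κ => by simp [hP, hQ], fun D hD => ?_⟩
    rcases Finset.mem_union.1 (MvPolynomial.vars_mul P Q hD) with h | h
    · exact hP' D h
    · exact hQ' D h

theorem derivative_mem_goodAlg {D : Diagram} (hD : D.Loopless) :
    (fun κ : Family => (D.derivative κ.1 : ℂ)) ∈ goodAlg :=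
  Algebra.subset_adjoin ⟨some D, fun D' h => by obtain rfl := Option.some.inj h; exact hD, rfl⟩

theorem inv_sqrt_gamma_mem_goodAlg :
    (fun κ : Family => ((1 / Real.sqrt (gamma κ.1) : ℝ) : ℂ)) ∈ goodAlg :=
  Algebra.subset_adjoin ⟨none, fun D h => by simp at h, rfl⟩

theorem derivative_singleEdge {κ : PointFunctions} (hκ : ContDiff ℝ ∞ (κ 2))
    (G : Fin 1 → Pair 2) : Diagram.derivative ⟨2, 1, G⟩ κ = -gamma κ := by
  have hG : (Pi.single (G 0) 1 : Pair 2 → ℝ) = fun _ => 1 := by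
    funext p
    have : p = G 0 := by
      obtain ⟨⟨a, b⟩, hab⟩ := p
      generalize G 0 = q
      obtain ⟨⟨a', b'⟩, hab'⟩ := q
      simp only at hab hab'
      simp only [Subtype.mk.injEq, Prod.mk.injEq]
      omega
    rw [this, Pi.single_eq_same]
  have h1 : HasDerivAt (rho κ) (fderiv ℝ (κ 2) 0 fun _ => 1) 0 := by
    have h2 : HasFDerivAt (κ 2) (fderiv ℝ (κ 2) 0) ((fun y : ℝ => (fun _ => y : Pair 2 → ℝ)) 0) :=
      (hκ.differentiable (by simp) _).hasFDerivAt
    have h3 : HasDerivAt (fun y : ℝ => (fun _ => y : Pair 2 → ℝ)) (fun _ => 1) 0 :=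
      hasDerivAt_pi.2 fun _ => hasDerivAt_id _
    exact h2.comp_hasDerivAt (0 : ℝ) h3
  rw [gamma, h1.deriv, neg_neg, Diagram.derivative, ← hG]
  exact iteratedFDeriv_one_apply _

/-- `γ` is minus the derivative whose diagram is a single edge, and one edge admits no loop of
length at least `2`. -/
theorem gamma_mem_goodAlg : (fun κ : Family => (gamma κ.1 : ℂ)) ∈ goodAlg := by
  have hD : Diagram.Loopless ⟨2, 1, fun _ => ⟨(0, 1), by decide⟩⟩ := by
    rintro K hK ⟨p, l, -, hl, -⟩
    have := Fintype.card_le_of_injective l hl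
    simp at this
    omega
  have h := neg_mem (derivative_mem_goodAlg hD)
  convert h using 1
  funext κ
  simp only [Pi.neg_apply]
  rw [derivative_singleEdge (κ.2.1 2)]
  simp

/-! ### Coefficients depending on `Θ` -/

variable {n : ℕ}

/-- A coefficient not depending on `Θ`. -/
def constFun (n : ℕ) (c : Family → ℂ) : Family → smoothFun n :=
  fun κ => algebraMap ℂ (smoothFun n) (c κ)

/-- The polynomials in the entries of `Θ` with coefficients in `goodAlg`. -/
def looplessAlg (n : ℕ) : Subalgebra ℝ (Family → smoothFun n) :=
  Algebra.adjoin ℝ ({f | ∃ c ∈ goodAlg, f = constFun n c} ∪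
    {f | ∃ p, f = fun _ => coordFun p})

theorem constFun_mem_looplessAlg {c : Family → ℂ} (hc : c ∈ goodAlg) :
    constFun n c ∈ looplessAlg n := Algebra.subset_adjoin (Or.inl ⟨c, hc, rfl⟩)

theorem coordFun_mem_looplessAlg (p : Fin n × Fin n) :
    (fun _ => coordFun p) ∈ looplessAlg n := Algebra.subset_adjoin (Or.inr ⟨p, rfl⟩)

/-- The coefficients which agree with an element of `looplessAlg` up to functions annihilated by
the determinantal operator. -/
def coeffAlg (n : ℕ) : Subalgebra ℝ (Family → smoothFun n) where
  carrier := {f | ∃ g ∈ looplessAlg n, ∀ κ, f κ - g κ ∈ nullIdeal n}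
  mul_mem' := by
    rintro f f' ⟨g, hg, h⟩ ⟨g', hg', h'⟩
    refine ⟨g * g', mul_mem hg hg', fun κ => ?_⟩
    have : (f * f') κ - (g * g') κ = f' κ * (f κ - g κ) + g κ * (f' κ - g' κ) := by
      simp only [Pi.mul_apply]; ring
    rw [this]
    exact add_mem (Ideal.mul_mem_left _ _ (h κ)) (Ideal.mul_mem_left _ _ (h' κ))
  add_mem' := by
    rintro f f' ⟨g, hg, h⟩ ⟨g', hg', h'⟩
    refine ⟨g + g', add_mem hg hg', fun κ => ?_⟩
    have : (f + f') κ - (g + g') κ = (f κ - g κ) + (f' κ - g' κ) := by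
      simp only [Pi.add_apply]; ring
    rw [this]
    exact add_mem (h κ) (h' κ)
  algebraMap_mem' r := ⟨algebraMap ℝ _ r, Subalgebra.algebraMap_mem _ r, fun κ => by simp⟩

theorem looplessAlg_le_coeffAlg : looplessAlg n ≤ coeffAlg n :=
  fun f hf => ⟨f, hf, fun κ => by simp⟩

theorem mem_coeffAlg_of_mem_nullIdeal {f : Family → smoothFun n} (hf : ∀ κ, f κ ∈ nullIdeal n) :
    f ∈ coeffAlg n := ⟨0, zero_mem _, fun κ => by simpa using hf κ⟩

/-- The polynomial multiplying `∏_b T_{I_b}` in `K_{u,v,w}`, for given indices `I`. -/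
def diagramCoeff {u v w M : ℕ} (G : Fin M → Pair (u + v + w)) (I : Fin v → Fin n) :
    Family → smoothFun n :=
  constFun n (fun κ => (M ! : ℂ)⁻¹ * (Diagram.derivative ⟨u + v + w, M, G⟩ κ.1 : ℂ)) *
    fun _ => diagramPoly G I


/-! ### Reality of the coefficients of the diagram polynomials -/

section Reality

open MvPolynomial

theorem exists_pairing_varProd_eq_ofReal {α : Type*} (m : Multiset α) :
    ∀ f : MvPolynomial α ℝ, ∃ r : ℝ, pairing (varProd m) (map Complex.ofRealHom f) = r := by
  induction m using Multiset.induction with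
  | empty =>
    intro f
    have : varProd (0 : Multiset α) = 1 := by simp [varProd]
    exact ⟨constantCoeff f, by rw [this, pairing_one, constantCoeff_map]; rfl⟩
  | cons e m ih =>
    intro f
    rw [varProd_cons, pairing_X_mul, pderiv_map]
    exact ih _

theorem exists_pairing_jetSymbol_eq_ofReal {N v w M : ℕ} (gv : Fin v → Fin N) (hv : Fin w → Fin N)
    (I : Fin v → Fin n) (J : Fin w → Fin n × Fin n) (G : Fin M → Pair N) :
    ∃ r : ℝ, pairing (jetSymbol gv hv I J) (∏ m, edgePoly n (G m)) = r := by
  have h1 : ∏ m, edgePoly n (G m) = map Complex.ofRealHom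
      (∏ m, ∑ i, C (1 / 2) * (X ((G m).1.1, i) - X ((G m).1.2, i)) ^ 2) := by
    simp [edgePoly]
  rw [h1, jetSymbol, Finset.prod_mul_distrib, prod_X_eq_varProd, prod_X_eq_varProd,
    prod_X_eq_varProd, ← varProd_add, ← varProd_add]
  exact exists_pairing_varProd_eq_ofReal _ _

theorem diagramPoly_mem_looplessAlg {u v w M : ℕ} (G : Fin M → Pair (u + v + w))
    (I : Fin v → Fin n) : (fun _ => diagramPoly G I) ∈ looplessAlg n := by
  choose r hr using fun J : Fin w → Fin n × Fin n => exists_pairing_jetSymbol_eq_ofReal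
    (fun b => Fin.castAdd w (Fin.natAdd u b)) (fun c => Fin.natAdd (u + v) c) I J G
  have h : (fun _ : Family => diagramPoly G I) =
      ∑ J : Fin w → Fin n × Fin n, r J • ∏ c, fun _ : Family => coordFun (J c) := by
    funext κ
    rw [Finset.sum_apply, diagramPoly]
    refine Finset.sum_congr rfl fun J _ => ?_
    rw [hr, Pi.smul_apply, Finset.prod_apply]
    rfl
  rw [h]
  exact sum_mem fun J _ => Subalgebra.smul_mem (looplessAlg n)
    (prod_mem fun c _ => coordFun_mem_looplessAlg (J c)) (r J)

end Reality

/-- Here the derivatives with loops leave the argument: loopless diagrams give elements of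
`looplessAlg`, all others are zero modulo `nullIdeal`. -/
theorem diagramCoeff_mem_coeffAlg {u v w M : ℕ} (G : Fin M → Pair (u + v + w))
    (I : Fin v → Fin n) : diagramCoeff G I ∈ coeffAlg n := by
  by_cases h : Diagram.Loopless ⟨u + v + w, M, G⟩
  · refine looplessAlg_le_coeffAlg (mul_mem (constFun_mem_looplessAlg ?_)
      (diagramPoly_mem_looplessAlg G I))
    have := goodAlg.smul_mem (derivative_mem_goodAlg h) ((M ! : ℝ)⁻¹)
    convert this using 1
    funext κ
    simp
  · simp only [Diagram.Loopless] at h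
    push Not at h
    obtain ⟨K, hK, hl⟩ := h
    exact mem_coeffAlg_of_mem_nullIdeal fun κ =>
      Ideal.mul_mem_left _ _ (diagramPoly_mem_nullIdeal G hK hl I)

/-! ### Polynomials in `i s` and `i T` -/

/-- The function `(i s)^a ∏_j (i T_j)^{α_j} f`. -/
def monomialFun (a : ℕ) (α : Fin n → ℕ) (f : Family → smoothFun n) :
    Family → ℝ → (Fin n → ℝ) → smoothFun n :=
  fun κ s T => ((Complex.I * s) ^ a * ∏ j, (Complex.I * T j) ^ α j) • f κ

/-- The polynomials in `i s` and `i T_j` with coefficients in `coeffAlg`. -/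
def fieldAlg (n : ℕ) : Subalgebra ℝ (Family → ℝ → (Fin n → ℝ) → smoothFun n) :=
  Algebra.adjoin ℝ {Ψ | ∃ a α, ∃ f ∈ coeffAlg n, Ψ = monomialFun a α f}

theorem monomialFun_mem (a : ℕ) (α : Fin n → ℕ) {f : Family → smoothFun n}
    (hf : f ∈ coeffAlg n) : monomialFun a α f ∈ fieldAlg n :=
  Algebra.subset_adjoin ⟨a, α, f, hf, rfl⟩

/-- The monomials are closed under multiplication, so the algebra is their real span; real scalars
are absorbed into `f`. Later arguments by linearity thus need only monomials and sums. -/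
theorem fieldAlg_induction
    {p : (Ψ : Family → ℝ → (Fin n → ℝ) → smoothFun n) → Ψ ∈ fieldAlg n → Prop}
    (mon : ∀ a α f (hf : f ∈ coeffAlg n), p (monomialFun a α f) (monomialFun_mem a α hf))
    (add : ∀ Ψ Ψ' hΨ hΨ', p Ψ hΨ → p Ψ' hΨ' → p (Ψ + Ψ') (add_mem hΨ hΨ')) {Ψ}
    (hΨ : Ψ ∈ fieldAlg n) : p Ψ hΨ := by
  set S : Submonoid (Family → ℝ → (Fin n → ℝ) → smoothFun n) :=
    { carrier := {Ψ | ∃ a α, ∃ f ∈ coeffAlg n, Ψ = monomialFun a α f}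
      mul_mem' := by
        rintro _ _ ⟨a, α, f, hf, rfl⟩ ⟨a', α', f', hf', rfl⟩
        refine ⟨a + a', α + α', f * f', mul_mem hf hf', ?_⟩
        funext κ s T
        simp only [monomialFun, Pi.mul_apply, Pi.add_apply, pow_add, Finset.prod_mul_distrib]
        rw [smul_mul_smul_comm]
        congr 1
        ring
      one_mem' := ⟨0, 0, 1, one_mem _, by funext κ s T; simp [monomialFun]⟩ } with hS
  have h1 : Ψ ∈ Submodule.span ℝ (S : Set (Family → ℝ → (Fin n → ℝ) → smoothFun n)) := by
    have h2 : Ψ ∈ Subalgebra.toSubmodule (fieldAlg n) := hΨ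
    rw [fieldAlg, Algebra.adjoin_eq_span] at h2
    have h3 : Submonoid.closure {Ψ | ∃ a α, ∃ f ∈ coeffAlg n, Ψ = monomialFun a α f} = S :=
      Submonoid.closure_eq S
    rwa [h3] at h2
  suffices H : ∃ h, p Ψ h from H.2
  clear hΨ
  induction h1 using Submodule.closure_induction with
  | zero =>
    have h : (0 : Family → ℝ → (Fin n → ℝ) → smoothFun n) = monomialFun 0 0 0 := by
      funext κ s T
      simp [monomialFun]
    rw [h]
    exact ⟨_, mon 0 0 0 (zero_mem _)⟩
  | add x y _ _ hx hy => exact ⟨_, add _ _ _ _ hx.2 hy.2⟩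
  | smul_mem r x hx =>
    obtain ⟨a, α, f, hf, rfl⟩ := hx
    have h : r • monomialFun a α f = monomialFun a α (r • f) := by
      funext κ s T
      simp only [monomialFun, Pi.smul_apply]
      rw [smul_comm]
    rw [h]
    exact ⟨_, mon a α (r • f) (Subalgebra.smul_mem _ hf r)⟩

theorem coeff_mem_fieldAlg {f : Family → smoothFun n} (hf : f ∈ coeffAlg n) :
    (fun κ _ _ => f κ) ∈ fieldAlg n :=
  Algebra.subset_adjoin ⟨0, 0, f, hf, by funext κ s T; simp [monomialFun]⟩

/-- The function `i s`. -/
def fieldS (n : ℕ) : Family → ℝ → (Fin n → ℝ) → smoothFun n :=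
  fun _ s _ => algebraMap ℂ _ (Complex.I * s)

/-- The function `i T_j`. -/
def fieldT (j : Fin n) : Family → ℝ → (Fin n → ℝ) → smoothFun n :=
  fun _ _ T => algebraMap ℂ _ (Complex.I * T j)

theorem fieldS_mem : fieldS n ∈ fieldAlg n :=
  Algebra.subset_adjoin ⟨1, 0, 1, one_mem _, by
    funext κ s T; simp [monomialFun, fieldS, Algebra.algebraMap_eq_smul_one]⟩

theorem fieldT_mem (j : Fin n) : fieldT j ∈ fieldAlg n :=
  Algebra.subset_adjoin ⟨0, Pi.single j 1, 1, one_mem _, by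
    funext κ s T
    rw [monomialFun, Finset.prod_eq_single j (fun i _ hi => by simp [hi]) (by simp)]
    simp [fieldT, Algebra.algebraMap_eq_smul_one]⟩

/-- `γ tr(Θ)`. -/
def gammaTrace (n : ℕ) : Family → smoothFun n :=
  constFun n (fun κ => (gamma κ.1 : ℂ)) * ∑ i : Fin n, fun _ => coordFun (i, i)

theorem gammaTrace_mem : gammaTrace n ∈ looplessAlg n :=
  mul_mem (constFun_mem_looplessAlg gamma_mem_goodAlg)
    (sum_mem fun _ _ => coordFun_mem_looplessAlg _)

theorem gammaTrace_apply (κ : Family) (Θ : Matrix (Fin n) (Fin n) ℝ) :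
    (gammaTrace n κ).1 Θ = ((gamma κ.1 * Θ.trace : ℝ) : ℂ) := by
  have : (∑ i : Fin n, fun _ : Family => coordFun (i, i)) κ = ∑ i : Fin n, coordFun (i, i) := by
    rw [Finset.sum_apply]
  change (gamma κ.1 : ℂ) * ((∑ i : Fin n, fun _ : Family => coordFun (i, i)) κ).1 Θ = _
  rw [this, smoothFun_sum_apply]
  simp [Matrix.trace, coordFun]

/-- The values at real `s`, `T` and `Θ` of a function of the field variables. -/
def fieldEval (κ : Family) (s : ℝ) (T : Fin n → ℝ) (Θ : Matrix (Fin n) (Fin n) ℝ) :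
    (Family → ℝ → (Fin n → ℝ) → smoothFun n) →+* ℂ where
  toFun Ψ := (Ψ κ s T).1 Θ
  map_one' := rfl
  map_mul' _ _ := rfl
  map_zero' := rfl
  map_add' _ _ := rfl

theorem fieldEval_smul (κ : Family) (s : ℝ) (T : Fin n → ℝ) (Θ : Matrix (Fin n) (Fin n) ℝ)
    (r : ℝ) (Ψ : Family → ℝ → (Fin n → ℝ) → smoothFun n) :
    fieldEval κ s T Θ (r • Ψ) = (r : ℂ) * fieldEval κ s T Θ Ψ := by
  change (r • (Ψ κ s T).1 Θ : ℂ) = _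
  rw [Complex.real_smul]
  rfl

/-- The argument `i s + γ tr(Θ)`. -/
def shiftedS (κ : Family) (s : ℝ) (Θ : Matrix (Fin n) (Fin n) ℝ) : ℂ :=
  Complex.I * (s : ℂ) + ((gamma κ.1 * Θ.trace : ℝ) : ℂ)

theorem exists_fieldEval_cumulantK (u v w : ℕ) : ∃ Ψ ∈ fieldAlg n, ∀ κ s T Θ,
    fieldEval κ s T Θ Ψ =
      cumulantK κ.1 u v w (shiftedS κ s Θ) (fun i => Complex.I * (T i : ℂ)) Θ := by
  by_cases hM : ∃ M, 2 * w + v = 2 * M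
  · obtain ⟨M, hM⟩ := hM
    refine ⟨(fieldS n + fun κ _ _ => gammaTrace n κ) ^ u *
      ∑ G : Fin M → Pair (u + v + w), ∑ I : Fin v → Fin n,
        (fun κ _ _ => diagramCoeff G I κ) * ∏ b, fieldT (I b),
      mul_mem (pow_mem (add_mem fieldS_mem
        (coeff_mem_fieldAlg (looplessAlg_le_coeffAlg gammaTrace_mem))) u)
        (sum_mem fun G _ => sum_mem fun I _ => mul_mem
          (coeff_mem_fieldAlg (diagramCoeff_mem_coeffAlg G I))
          (prod_mem fun b _ => fieldT_mem _)), fun κ s T Θ => ?_⟩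
    rw [cumulantK_eq (κ.2.1 _) _ _ _ hM, map_mul, map_pow, map_add]
    congr 2
    · rw [shiftedS, ← gammaTrace_apply]
      rfl
    · simp only [map_sum, map_mul, map_prod]
      refine Finset.sum_congr rfl fun G _ => Finset.sum_congr rfl fun I _ => ?_
      have h1 : fieldEval κ s T Θ (fun κ _ _ => diagramCoeff G I κ) =
        (M ! : ℂ)⁻¹ * (Diagram.derivative ⟨u + v + w, M, G⟩ κ.1 : ℂ) * (diagramPoly G I).1 Θ := rfl
      have h2 : ∀ b, fieldEval κ s T Θ (fieldT (I b)) = Complex.I * T (I b) := fun b => rfl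
      rw [h1, Finset.prod_congr rfl fun b _ => h2 b]
      ring
  · push Not at hM
    refine ⟨0, zero_mem _, fun κ s T Θ => ?_⟩
    rw [cumulantK_eq_zero (κ.2.1 _) _ _ _ hM, map_zero]

theorem exists_fieldEval_cumulantQ (N : ℕ) : ∃ Ψ ∈ fieldAlg n, ∀ κ s T Θ,
    fieldEval κ s T Θ Ψ =
      cumulantQ κ.1 N (shiftedS κ s Θ) (fun i => Complex.I * (T i : ℂ)) Θ := by
  choose K hK hK' using fun u v w => exists_fieldEval_cumulantK (n := n) u v w
  refine ⟨∑ p ∈ Finset.HasAntidiagonal.antidiagonal N,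
    ∑ q ∈ Finset.HasAntidiagonal.antidiagonal p.1,
      ((q.1 ! : ℝ) * (q.2 ! : ℝ) * (p.2 ! : ℝ))⁻¹ • K q.1 q.2 p.2,
    sum_mem fun p _ => sum_mem fun q _ => Subalgebra.smul_mem _ (hK _ _ _) _,
    fun κ s T Θ => ?_⟩
  simp only [map_sum, cumulantQ]
  refine Finset.sum_congr rfl fun p _ => Finset.sum_congr rfl fun q _ => ?_
  rw [fieldEval_smul, hK']
  push_cast
  field_simp

theorem exists_fieldEval_mgf (m : ℕ) : ∃ Ψ ∈ fieldAlg n, ∀ κ s T Θ,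
    fieldEval κ s T Θ Ψ = ∑ r ∈ Finset.range (m + 1),
      PowerSeries.coeff m (higherCumulants κ.1 (shiftedS κ s Θ)
        (fun i => Complex.I * (T i : ℂ)) Θ ^ r) / (r ! : ℂ) := by
  choose Q hQ hQ' using fun N => exists_fieldEval_cumulantQ (n := n) N
  set H : PowerSeries (Family → ℝ → (Fin n → ℝ) → smoothFun n) :=
    PowerSeries.mk fun k => if k = 0 then 0 else Q (k + 2) with hH
  have hmem : ∀ r k, PowerSeries.coeff k (H ^ r) ∈ fieldAlg n := by
    intro r
    induction r with
    | zero =>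
      intro k
      rw [pow_zero, PowerSeries.coeff_one]
      split_ifs
      · exact one_mem _
      · exact zero_mem _
    | succ r ih =>
      intro k
      rw [pow_succ, PowerSeries.coeff_mul]
      refine sum_mem fun p _ => mul_mem (ih _) ?_
      rw [hH, PowerSeries.coeff_mk]
      split_ifs
      · exact zero_mem _
      · exact hQ _
  refine ⟨∑ r ∈ Finset.range (m + 1), ((r ! : ℝ))⁻¹ • PowerSeries.coeff m (H ^ r),
    sum_mem fun r _ => Subalgebra.smul_mem _ (hmem r m) _, fun κ s T Θ => ?_⟩
  -- Evaluation is a ring homomorphism, so it commutes with the coefficients of powers of a formal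
  -- series.
  have hmap : higherCumulants κ.1 (shiftedS κ s Θ) (fun i => Complex.I * (T i : ℂ)) Θ =
      PowerSeries.map (fieldEval κ s T Θ) H := by
    ext k
    rw [higherCumulants, hH, PowerSeries.coeff_map, PowerSeries.coeff_mk, PowerSeries.coeff_mk]
    split_ifs
    · simp
    · rw [hQ']
  rw [hmap, map_sum]
  refine Finset.sum_congr rfl fun r _ => ?_
  rw [fieldEval_smul, ← map_pow, PowerSeries.coeff_map]
  push_cast
  field_simp


/-! ### The second cumulants -/

section SecondCumulants

open MvPolynomial

theorem pairing_X_mul_X_edgePoly {N : ℕ} (p : Pair N) (a b : Fin N) (i j : Fin n) :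
    pairing (X (a, i) * X (b, j)) (edgePoly n p) = if i = j then
      ((if p.1.1 = a then 1 else 0) - (if p.1.2 = a then 1 else 0)) *
      ((if p.1.1 = b then 1 else 0) - (if p.1.2 = b then 1 else 0)) else 0 := by
  have hX : ∀ c : Fin N, constantCoeff (pderiv (b, j) (X (c, i) : MvPolynomial (Fin N × Fin n) ℂ)) =
      if i = j then (if c = b then 1 else 0) else 0 := by
    intro c
    rw [pderiv_X, Pi.single_apply]
    by_cases h1 : c = b <;> by_cases h2 : i = j <;> simp [h1, h2]
  have hc : ((if p.1.1 = a then 1 else 0) - (if p.1.2 = a then 1 else 0) :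
      MvPolynomial (Fin N × Fin n) ℂ) =
      C ((if p.1.1 = a then 1 else 0) - (if p.1.2 = a then 1 else 0)) := by
    split_ifs <;> simp
  rw [pairing_X_mul, ← mul_one (X (b, j)), pairing_X_mul, pairing_one, pderiv_edgePoly, hc,
    mul_comm, pderiv_C_mul, map_mul, constantCoeff_C, map_sub, map_sub, hX, hX]
  split_ifs <;> simp

theorem pair_two_eq (p : Pair 2) : p.1.1 = 0 ∧ p.1.2 = 1 := by
  obtain ⟨⟨a, b⟩, hab⟩ := p
  simp only at hab
  simp only
  omega

theorem fin_one_pair_two_eq (G G' : Fin 1 → Pair 2) : G = G' := by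
  funext k
  obtain ⟨h1, h2⟩ := pair_two_eq (G k)
  obtain ⟨h3, h4⟩ := pair_two_eq (G' k)
  exact Subtype.ext (Prod.ext (h1.trans h3.symm) (h2.trans h4.symm))

theorem cumulantK_two_zero_zero (κ : Family) (s : ℂ) (T : Fin n → ℂ)
    (Θ : Matrix (Fin n) (Fin n) ℝ) : cumulantK κ.1 2 0 0 s T Θ = s ^ 2 := by
  have h : halfSqDist (0 : Fin (2 + 0 + 0) → Fin n → ℝ) = fun _ => 0 := by
    funext p
    simp [halfSqDist]
  have h2 : κ.1 (2 + 0 + 0) (fun _ => 0) = 1 := κ.2.2.1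
  simp [cumulantK, h, h2]

theorem cumulantK_zero_two_zero (κ : Family) (s : ℂ) (T : Fin n → ℂ)
    (Θ : Matrix (Fin n) (Fin n) ℝ) :
    cumulantK κ.1 0 2 0 s T Θ = gamma κ.1 * ∑ i, T i ^ 2 := by
  have hG : ∀ G : Fin 1 → Pair (0 + 2 + 0), Diagram.derivative ⟨0 + 2 + 0, 1, G⟩ κ.1 =
      -gamma κ.1 := fun G => derivative_singleEdge (κ.2.1 2) G
  have hP : ∀ (G : Fin 1 → Pair (0 + 2 + 0)) (I : Fin 2 → Fin n),
      (diagramPoly (w := 0) G I).1 Θ = if I 0 = I 1 then -1 else 0 := by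
    intro G I
    obtain ⟨h1, h2⟩ := pair_two_eq (G 0)
    have h3 : jetSymbol (fun b : Fin 2 => Fin.castAdd 0 (Fin.natAdd 0 b))
        (fun c => Fin.natAdd (0 + 2) c) I default =
        X ((0 : Fin (0 + 2 + 0)), I 0) * X ((1 : Fin (0 + 2 + 0)), I 1) := by
      rw [jetSymbol, Fin.prod_univ_two]
      simp
    rw [diagramPoly_apply, Fintype.sum_unique, h3, Fin.prod_univ_one, pairing_X_mul_X_edgePoly]
    simp only [h1, h2]
    simp
  rw [cumulantK_eq (M := 1) (κ.2.1 _) s T Θ (by norm_num),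
    Fintype.sum_eq_single (fun _ => ⟨(0, 1), by decide⟩)
      fun G h => absurd (fin_one_pair_two_eq _ _) h,
    ← (finTwoArrowEquiv (Fin n)).symm.sum_comp, Fintype.sum_prod_type]
  simp only [hG, hP, Fin.prod_univ_two]
  simp [finTwoArrowEquiv, Finset.mul_sum]
  refine Finset.sum_congr rfl fun i _ => ?_
  ring

theorem cumulantK_one_zero_one (κ : Family) (s : ℂ) (T : Fin n → ℂ)
    (Θ : Matrix (Fin n) (Fin n) ℝ) :
    cumulantK κ.1 1 0 1 s T Θ = -(s * ((gamma κ.1 * Θ.trace : ℝ) : ℂ)) := by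
  have hG : ∀ G : Fin 1 → Pair (1 + 0 + 1), Diagram.derivative ⟨1 + 0 + 1, 1, G⟩ κ.1 =
      -gamma κ.1 := fun G => derivative_singleEdge (κ.2.1 2) G
  have hP : ∀ (G : Fin 1 → Pair (1 + 0 + 1)) (I : Fin 0 → Fin n),
      (diagramPoly (w := 1) G I).1 Θ = Θ.trace := by
    intro G I
    obtain ⟨h1, h2⟩ := pair_two_eq (G 0)
    rw [diagramPoly_apply, ← (Equiv.funUnique (Fin 1) (Fin n × Fin n)).symm.sum_comp,
      Fintype.sum_prod_type, Matrix.trace]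
    push_cast
    refine Finset.sum_congr rfl fun i _ => ?_
    have h3 : ∀ j, jetSymbol (fun b : Fin 0 => Fin.castAdd 1 (Fin.natAdd 1 b))
        (fun c => Fin.natAdd (1 + 0) c) I ((Equiv.funUnique (Fin 1) (Fin n × Fin n)).symm (i, j)) =
        X ((1 : Fin (1 + 0 + 1)), i) * X ((1 : Fin (1 + 0 + 1)), j) := by
      intro j
      rw [jetSymbol, Fin.prod_univ_one, Fin.prod_univ_zero, one_mul]
      rfl
    simp only [h3, Fin.prod_univ_one, pairing_X_mul_X_edgePoly, h1, h2]
    simp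
  rw [cumulantK_eq (M := 1) (κ.2.1 _) s T Θ (by norm_num),
    Fintype.sum_eq_single (fun _ => ⟨(0, 1), by decide⟩)
      fun G h => absurd (fin_one_pair_two_eq _ _) h, Fintype.sum_unique]
  simp only [hG, hP]
  simp

/-- The quadratic form in `Θ` proportional to `ρ''(0)` in the second cumulants. -/
def secondOrder (n : ℕ) : Family → smoothFun n := fun κ =>
  ∑ G : Fin 2 → Pair (0 + 0 + 2), ∑ I : Fin 0 → Fin n, diagramCoeff G I κ

/-- Two edges on two points are necessarily parallel, a loop of length `2`. -/
theorem secondOrder_mem_nullIdeal (κ : Family) : secondOrder n κ ∈ nullIdeal n := by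
  refine sum_mem fun G _ => sum_mem fun I _ => Ideal.mul_mem_left _ _ ?_
  refine diagramPoly_mem_nullIdeal (K := 2) G le_rfl
    ⟨fun k => k, fun k => k, fun _ _ h => h, fun _ _ h => h, fun k => ?_⟩ I
  obtain ⟨h1, h2⟩ := pair_two_eq (G k)
  simp only
  rw [h1, h2]
  fin_cases k
  · rfl
  · exact Sym2.eq_swap

theorem cumulantK_zero_zero_two (κ : Family) (s : ℂ) (T : Fin n → ℂ)
    (Θ : Matrix (Fin n) (Fin n) ℝ) :
    cumulantK κ.1 0 0 2 s T Θ = (secondOrder n κ).1 Θ := by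
  rw [cumulantK_eq (M := 2) (κ.2.1 _) s T Θ (by norm_num), secondOrder, smoothFun_sum_apply,
    pow_zero, one_mul]
  refine Finset.sum_congr rfl fun G _ => ?_
  rw [smoothFun_sum_apply]
  refine Finset.sum_congr rfl fun I _ => ?_
  rw [Finset.univ_eq_empty, Finset.prod_empty, mul_one]
  rfl

theorem cumulantQ_two (κ : Family) (s : ℂ) (T : Fin n → ℂ) (Θ : Matrix (Fin n) (Fin n) ℝ) :
    cumulantQ κ.1 2 s T Θ = s ^ 2 / 2 - s * ((gamma κ.1 * Θ.trace : ℝ) : ℂ) +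
      gamma κ.1 * (∑ i, T i ^ 2) / 2 + (secondOrder n κ).1 Θ / 2 := by
  have h1 : cumulantK κ.1 1 1 0 s T Θ = 0 := cumulantK_eq_zero (κ.2.1 _) s T Θ (by intro M; omega)
  have h2 : cumulantK κ.1 0 1 1 s T Θ = 0 := cumulantK_eq_zero (κ.2.1 _) s T Θ (by intro M; omega)
  simp only [cumulantQ, Finset.Nat.antidiagonal_succ, Finset.Nat.antidiagonal_zero,
    Finset.sum_cons, Finset.map_singleton, Finset.sum_singleton,
    Function.Embedding.prodMap, Function.Embedding.coeFn_mk, Prod.map, Finset.map_cons,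
    Function.Embedding.refl_apply, Nat.succ_eq_add_one, zero_add, Nat.reduceAdd]
  rw [cumulantK_two_zero_zero, cumulantK_zero_two_zero, cumulantK_one_zero_one,
    cumulantK_zero_zero_two, h1, h2]
  simp
  ring

/-- With `g = γ tr Θ`, `(i s + g)² / 2 - (i s + g) g = -s² / 2 - g² / 2`: the mixed term disappears,
so the Gaussian weight of `s` is independent of `Θ`. -/
theorem cumulantQ_two_shifted (κ : Family) (s : ℝ) (T : Fin n → ℝ)
    (Θ : Matrix (Fin n) (Fin n) ℝ) :
    cumulantQ κ.1 2 (shiftedS κ s Θ) (fun i => Complex.I * (T i : ℂ)) Θ =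
      -(s : ℂ) ^ 2 / 2 + (∑ i, -((gamma κ.1 : ℂ) * (T i : ℂ) ^ 2 / 2)) +
        (-((gammaTrace n κ).1 Θ) ^ 2 / 2 + (secondOrder n κ).1 Θ / 2) := by
  rw [cumulantQ_two, shiftedS, gammaTrace_apply]
  have h : ∑ i, (Complex.I * (T i : ℂ)) ^ 2 = -∑ i, (T i : ℂ) ^ 2 := by
    rw [← Finset.sum_neg_distrib]
    refine Finset.sum_congr rfl fun i _ => ?_
    rw [mul_pow, Complex.I_sq]
    ring
  rw [h, Finset.sum_neg_distrib, ← Finset.sum_div, ← Finset.mul_sum]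
  linear_combination (s : ℂ) ^ 2 / 2 * Complex.I_sq

end SecondCumulants


/-! ### Gaussian moments -/

section Gaussian

open MeasureTheory

theorem norm_ofReal_cexp_neg_mul_sq (b s : ℝ) :
    ‖Complex.exp (-((b : ℂ) * (s : ℂ) ^ 2 / 2))‖ = Real.exp (-(b / 2) * s ^ 2) := by
  rw [Complex.norm_exp]
  congr 1
  have : -((b : ℂ) * (s : ℂ) ^ 2 / 2) = ((-(b / 2) * s ^ 2 : ℝ) : ℂ) := by push_cast; ring
  rw [this, Complex.ofReal_re]

theorem integrable_pow_mul_gaussian {b : ℝ} (hb : 0 < b) (k : ℕ) :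
    Integrable fun s : ℝ => (Complex.I * s) ^ k * Complex.exp (-((b : ℂ) * (s : ℂ) ^ 2 / 2)) := by
  have h := integrable_rpow_mul_exp_neg_mul_sq (half_pos hb)
    (lt_of_lt_of_le neg_one_lt_zero (Nat.cast_nonneg k))
  simp only [Real.rpow_natCast] at h
  refine Integrable.mono h (Continuous.aestronglyMeasurable (by fun_prop))
    (Filter.Eventually.of_forall fun s => le_of_eq ?_)
  rw [norm_mul, norm_ofReal_cexp_neg_mul_sq, norm_pow, norm_mul, Complex.norm_I, one_mul,
    Complex.norm_real, norm_mul, norm_pow, Real.norm_of_nonneg (Real.exp_pos _).le]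

theorem integrable_fourier_mul {f : ℝ → ℂ} (hf : Integrable f) (x : ℝ) :
    Integrable fun s : ℝ => Complex.exp (-(Complex.I * (s : ℂ) * (x : ℂ))) * f s := by
  refine Integrable.mono hf ((Continuous.aestronglyMeasurable (by fun_prop)).mul
    hf.aestronglyMeasurable) (Filter.Eventually.of_forall fun s => le_of_eq ?_)
  have : -(Complex.I * (s : ℂ) * (x : ℂ)) = ((-(s * x) : ℝ) : ℂ) * Complex.I := by push_cast; ring
  rw [norm_mul, this, Complex.norm_exp_ofReal_mul_I, one_mul]

/-- The integrand of the Fourier transform of `(i s)^k e^{-s²/2}`. -/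
def gaussIntegrand (k : ℕ) (x s : ℝ) : ℂ :=
  Complex.exp (-(Complex.I * (s : ℂ) * (x : ℂ))) *
    ((Complex.I * s) ^ k * Complex.exp (-((s : ℂ) ^ 2 / 2)))

theorem integrable_gaussIntegrand (k : ℕ) (x : ℝ) : Integrable (gaussIntegrand k x) := by
  have := integrable_fourier_mul (integrable_pow_mul_gaussian one_pos k) x
  simp only [Complex.ofReal_one, one_mul] at this
  exact this

theorem integral_gaussIntegrand_zero (x : ℝ) :
    ∫ s, gaussIntegrand 0 x s = ((Real.sqrt (2 * Real.pi) * Real.exp (-x ^ 2 / 2) : ℝ) : ℂ) := by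
  have h := fourierIntegral_gaussian (b := 1 / 2) (by norm_num) (-(x : ℂ))
  have h1 : ∀ s : ℝ, gaussIntegrand 0 x s =
      Complex.exp (Complex.I * (-(x : ℂ)) * s) * Complex.exp (-(1 / 2) * (s : ℂ) ^ 2) := by
    intro s
    rw [gaussIntegrand, pow_zero, one_mul]
    congr 2 <;> ring
  simp only [h1, h]
  have h2 : ((Real.pi : ℂ) / (1 / 2)) ^ (1 / 2 : ℂ) = ((Real.sqrt (2 * Real.pi) : ℝ) : ℂ) := by
    rw [Real.sqrt_eq_rpow, Complex.ofReal_cpow (by positivity)]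
    congr 1
    · push_cast; ring
    · push_cast; ring
  rw [h2, Complex.ofReal_mul, Complex.ofReal_exp]
  congr 2
  push_cast
  ring

theorem hasDerivAt_gaussIntegrand (k : ℕ) (x s : ℝ) :
    HasDerivAt (gaussIntegrand k x) (Complex.I * (gaussIntegrand (k + 1) x s -
      x * gaussIntegrand k x s + k * gaussIntegrand (k - 1) x s)) s := by
  have h0 : HasDerivAt (fun s : ℝ => (s : ℂ)) 1 s := Complex.ofRealCLM.hasDerivAt
  have h1 : HasDerivAt (fun s : ℝ => Complex.exp (-(Complex.I * (s : ℂ) * (x : ℂ))))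
      (Complex.exp (-(Complex.I * (s : ℂ) * (x : ℂ))) * -(Complex.I * 1 * x)) s :=
    (((h0.const_mul Complex.I).mul_const (x : ℂ)).neg).cexp
  have h2 : HasDerivAt (fun s : ℝ => (Complex.I * s) ^ k)
      (k * (Complex.I * s) ^ (k - 1) * (Complex.I * 1)) s := (h0.const_mul Complex.I).pow k
  have h3 : HasDerivAt (fun s : ℝ => Complex.exp (-((s : ℂ) ^ 2 / 2)))
      (Complex.exp (-((s : ℂ) ^ 2 / 2)) * -((2 : ℕ) * (s : ℂ) ^ (2 - 1) * 1 / 2)) s :=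
    (((h0.pow 2).div_const 2).neg).cexp
  refine (h1.mul (h2.mul h3)).congr_deriv ?_
  simp only [gaussIntegrand, pow_succ (Complex.I * (s : ℂ)) k, Pi.mul_apply]
  push_cast
  linear_combination (-(s : ℂ) * Complex.exp (-(Complex.I * s * x)) * (Complex.I * s) ^ k *
    Complex.exp (-((s : ℂ) ^ 2 / 2))) * Complex.I_sq

/-- Integration by parts: the Hermite recursion. For `k = 0` the truncated `k - 1` is harmless
because its coefficient is zero. -/
theorem integral_gaussIntegrand_succ (k : ℕ) (x : ℝ) :
    ∫ s, gaussIntegrand (k + 1) x s =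
      x * (∫ s, gaussIntegrand k x s) - k * ∫ s, gaussIntegrand (k - 1) x s := by
  have hi := integrable_gaussIntegrand (x := x)
  have h1 : Integrable fun s => gaussIntegrand (k + 1) x s - x * gaussIntegrand k x s :=
    (hi _).sub ((hi _).const_mul _)
  have h2 : Integrable fun s => gaussIntegrand (k + 1) x s - x * gaussIntegrand k x s +
    k * gaussIntegrand (k - 1) x s := h1.add ((hi _).const_mul _)
  have h := integral_eq_zero_of_hasDerivAt_of_integrable
    (fun s => hasDerivAt_gaussIntegrand k x s) (h2.const_mul _) (hi k)
  rw [integral_const_mul, integral_add h1 ((hi _).const_mul _), integral_sub (hi _)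
    ((hi _).const_mul _), integral_const_mul, integral_const_mul] at h
  have h' := (mul_eq_zero.1 h).resolve_left Complex.I_ne_zero
  linear_combination h'

theorem exists_polynomial_integral_gaussIntegrand (k : ℕ) : ∃ p : Polynomial ℝ, ∀ x : ℝ,
    ∫ s, gaussIntegrand k x s = ((p.eval x * Real.exp (-x ^ 2 / 2) : ℝ) : ℂ) := by
  induction k using Nat.strong_induction_on with
  | _ k ih =>
    match k with
    | 0 => exact ⟨Polynomial.C (Real.sqrt (2 * Real.pi)), fun x => by
        rw [integral_gaussIntegrand_zero, Polynomial.eval_C]⟩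
    | k + 1 =>
      obtain ⟨p, hp⟩ := ih k (by omega)
      obtain ⟨q, hq⟩ := ih (k - 1) (by omega)
      refine ⟨Polynomial.X * p - Polynomial.C (k : ℝ) * q, fun x => ?_⟩
      rw [integral_gaussIntegrand_succ, hp, hq]
      simp only [Polynomial.eval_sub, Polynomial.eval_mul, Polynomial.eval_X, Polynomial.eval_C]
      push_cast
      ring

theorem exists_integral_pow_mul_gaussian (k : ℕ) : ∃ r : ℝ, ∀ b : ℝ, 0 < b →
    ∫ t : ℝ, (Complex.I * t) ^ k * Complex.exp (-((b : ℂ) * (t : ℂ) ^ 2 / 2)) =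
      (((1 / Real.sqrt b) ^ (k + 1) * r : ℝ) : ℂ) := by
  obtain ⟨p, hp⟩ := exists_polynomial_integral_gaussIntegrand k
  -- Rescaling by `√b` reduces to `b = 1` and `x = 0`; the power contributes `√b ^ (-k)` and the
  -- measure one more inverse factor.
  refine ⟨p.eval 0, fun b hb => ?_⟩
  have hb' : 0 < Real.sqrt b := Real.sqrt_pos.2 hb
  have h := Measure.integral_comp_mul_left (gaussIntegrand k 0) (Real.sqrt b)
  have h1 : ∀ t : ℝ, gaussIntegrand k 0 (Real.sqrt b * t) = ((Real.sqrt b ^ k : ℝ) : ℂ) *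
      ((Complex.I * t) ^ k * Complex.exp (-((b : ℂ) * (t : ℂ) ^ 2 / 2))) := by
    intro t
    have h2 : ((Real.sqrt b * t : ℝ) : ℂ) ^ 2 = b * t ^ 2 := by
      rw [← Complex.ofReal_pow, mul_pow, Real.sq_sqrt hb.le]
      push_cast
      ring
    rw [gaussIntegrand, h2]
    push_cast
    simp
    ring
  simp only [h1] at h
  rw [integral_const_mul, hp] at h
  have h3 : ((Real.sqrt b ^ k : ℝ) : ℂ) ≠ 0 := by
    exact_mod_cast (pow_pos hb' k).ne'
  apply mul_left_cancel₀ h3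
  rw [h, abs_of_pos (inv_pos.2 hb'), Complex.real_smul, ← Complex.ofReal_mul, ← Complex.ofReal_mul]
  congr 1
  have := hb'.ne'
  simp
  field_simp
  ring

/-- The value of `(i T)^α` times the Gaussian density with covariance `γ^{-1}`, up to a constant. -/
def vectorGaussian (b : ℝ) (α : Fin n → ℕ) (T : Fin n → ℝ) : ℂ :=
  ∏ j, ((Complex.I * T j) ^ α j * Complex.exp (-((b : ℂ) * (T j : ℂ) ^ 2 / 2)))

theorem integrable_vectorGaussian {b : ℝ} (hb : 0 < b) (α : Fin n → ℕ) :
    Integrable (vectorGaussian b α) :=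
  Integrable.fintype_prod (f := fun j (t : ℝ) =>
    (Complex.I * t) ^ α j * Complex.exp (-((b : ℂ) * (t : ℂ) ^ 2 / 2)))
    fun j => integrable_pow_mul_gaussian hb (α j)

theorem integral_vectorGaussian_mem_goodAlg (α : Fin n → ℕ) :
    (fun κ : Family => (1 / (2 * Real.pi : ℂ) ^ n) * ∫ T, vectorGaussian (gamma κ.1) α T) ∈
      goodAlg := by
  choose r hr using exists_integral_pow_mul_gaussian
  have h : (fun κ : Family => (1 / (2 * Real.pi : ℂ) ^ n) *
      ∫ T, vectorGaussian (gamma κ.1) α T) = ((1 / (2 * Real.pi) ^ n : ℝ)) •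
        ∏ j, (r (α j) •
          (fun κ : Family => ((1 / Real.sqrt (gamma κ.1) : ℝ) : ℂ)) ^ (α j + 1)) := by
    funext κ
    have h1 : ∫ T, vectorGaussian (gamma κ.1) α T =
        ∏ j, (((1 / Real.sqrt (gamma κ.1)) ^ (α j + 1) * r (α j) : ℝ) : ℂ) := by
      have := integral_fintype_prod_volume_eq_prod (𝕜 := ℂ) (fun (j : Fin n) (t : ℝ) =>
        (Complex.I * t) ^ α j * Complex.exp (-((gamma κ.1 : ℂ) * (t : ℂ) ^ 2 / 2)))
      simp only [vectorGaussian]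
      rw [this]
      exact Finset.prod_congr rfl fun j _ => hr _ _ κ.2.2.2
    rw [h1, Pi.smul_apply, Finset.prod_apply, Complex.real_smul]
    congr 1
    · push_cast; rfl
    · refine Finset.prod_congr rfl fun j _ => ?_
      rw [Pi.smul_apply, Pi.pow_apply, Complex.real_smul]
      push_cast
      ring
  rw [h]
  exact goodAlg.smul_mem (prod_mem fun j _ =>
    goodAlg.smul_mem (pow_mem inv_sqrt_gamma_mem_goodAlg _) _) _

end Gaussian


/-! ### Exponentials of smooth functions -/

/-- The exponential of a smooth function. -/
def expFun (f : smoothFun n) : smoothFun n :=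
  ⟨fun Θ => Complex.exp (f.1 Θ), (contDiff_of_mem f.2).cexp⟩

theorem expFun_add (f g : smoothFun n) : expFun (f + g) = expFun f * expFun g := by
  ext Θ
  exact Complex.exp_add (f.1 Θ) (g.1 Θ)

theorem contDiff_dslope_exp : ContDiff ℝ ∞ (dslope Complex.exp 0) :=
  ContDiff.restrict_scalars ℝ (𝕜' := ℂ) (Differentiable.contDiff (differentiableOn_univ.1
    ((Complex.differentiableOn_dslope Filter.univ_mem).2
      Complex.differentiable_exp.differentiableOn)))

/-- `e^z - 1` is `z` times an entire function, so `expFun f - 1` is a smooth multiple of `f`. -/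
theorem expFun_sub_one_mem {I : Ideal (smoothFun n)} {f : smoothFun n} (hf : f ∈ I) :
    expFun f - 1 ∈ I := by
  have h : expFun f - 1 = f * ⟨fun Θ => dslope Complex.exp 0 (f.1 Θ),
      contDiff_dslope_exp.comp (contDiff_of_mem f.2)⟩ := by
    ext Θ
    have := sub_smul_dslope Complex.exp 0 (f.1 Θ)
    rw [sub_zero, Complex.exp_zero, smul_eq_mul] at this
    exact this.symm
  rw [h]
  exact Ideal.mul_mem_right _ _ hf

theorem thetaDeriv_expFun (i j : Fin n) (f : smoothFun n) :
    thetaDeriv i j (expFun f) = expFun f * thetaDeriv i j f := by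
  ext Θ
  have hf := (contDiff_of_mem f.2).differentiable (by simp) (Matrix.of.symm Θ)
  change DTheta i j (expFun f).1 Θ = Complex.exp (f.1 Θ) * DTheta i j f.1 Θ
  rw [DTheta_eq_fderiv i j f.2, DTheta_eq_fderiv i j (expFun f).2]
  exact congrArg (fun L : (Fin n → Fin n → ℝ) →L[ℝ] ℂ => L (Matrix.of.symm (symDir i j)))
    hf.hasFDerivAt.cexp.fderiv

/-! ### Polynomials times a Gaussian in `x` -/

/-- The function `q(x) e^{-x²/2} f`. -/
def gaussFun (q : Polynomial ℝ) (f : Family → smoothFun n) : Family → ℝ → smoothFun n :=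
  fun κ x => ((q.eval x * Real.exp (-x ^ 2 / 2) : ℝ) : ℂ) • f κ

/-- The sums of functions `q(x) e^{-x²/2} f` with `f` in a given algebra. -/
def gaussModule (A : Subalgebra ℝ (Family → smoothFun n)) :
    AddSubmonoid (Family → ℝ → smoothFun n) :=
  AddSubmonoid.closure {h | ∃ q, ∃ f ∈ A, h = gaussFun q f}

theorem gaussFun_mem {A : Subalgebra ℝ (Family → smoothFun n)} {f : Family → smoothFun n}
    (q : Polynomial ℝ) (hf : f ∈ A) : gaussFun q f ∈ gaussModule A :=
  AddSubmonoid.subset_closure ⟨q, f, hf, rfl⟩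

theorem gaussModule_induction {A : Subalgebra ℝ (Family → smoothFun n)}
    {p : (h : Family → ℝ → smoothFun n) → h ∈ gaussModule A → Prop}
    (mon : ∀ q f (hf : f ∈ A), p (gaussFun q f) (gaussFun_mem q hf))
    (add : ∀ h h' hh hh', p h hh → p h' hh' → p (h + h') (add_mem hh hh')) {h}
    (hh : h ∈ gaussModule A) : p h hh := by
  induction hh using AddSubmonoid.closure_induction with
  | mem h hh =>
    obtain ⟨q, f, hf, rfl⟩ := hh
    exact mon q f hf
  | zero =>
    suffices H : ∃ h0, p 0 h0 from H.2
    have h : (0 : Family → ℝ → smoothFun n) = gaussFun 0 0 := by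
      funext κ x
      simp [gaussFun]
    rw [h]
    exact ⟨_, mon 0 0 (zero_mem A)⟩
  | add h h' hh hh' ih ih' => exact add h h' hh hh' ih ih'

theorem exists_mem_gaussModule_looplessAlg {h : Family → ℝ → smoothFun n}
    (hh : h ∈ gaussModule (coeffAlg n)) :
    ∃ h' ∈ gaussModule (looplessAlg n), ∀ κ x, h κ x - h' κ x ∈ nullIdeal n := by
  induction hh using gaussModule_induction with
  | mon q f hf =>
    obtain ⟨g, hg, hfg⟩ := hf
    refine ⟨gaussFun q g, gaussFun_mem q hg, fun κ x => ?_⟩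
    rw [gaussFun, gaussFun, ← smul_sub, Algebra.smul_def]
    exact Ideal.mul_mem_left _ _ (hfg κ)
  | add h₁ h₂ _ _ ih₁ ih₂ =>
    obtain ⟨g₁, hg₁, h₁'⟩ := ih₁
    obtain ⟨g₂, hg₂, h₂'⟩ := ih₂
    refine ⟨g₁ + g₂, add_mem hg₁ hg₂, fun κ x => ?_⟩
    simp only [Pi.add_apply]
    rw [add_sub_add_comm]
    exact add_mem (h₁' κ x) (h₂' κ x)

/-! ### The Gaussian integrals over the fields -/

section Integrals

open MeasureTheory

/-- The Gaussian weight of `T`. -/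
def weightT (κ : Family) (T : Fin n → ℝ) : ℂ :=
  ∏ j, Complex.exp (-((gamma κ.1 : ℂ) * (T j : ℂ) ^ 2 / 2))

theorem weightT_mul_fieldEval_monomialFun (a : ℕ) (α : Fin n → ℕ) (f : Family → smoothFun n)
    (κ : Family) (s : ℝ) (T : Fin n → ℝ) (Θ : Matrix (Fin n) (Fin n) ℝ) :
    weightT κ T * fieldEval κ s T Θ (monomialFun a α f) =
      vectorGaussian (gamma κ.1) α T * ((Complex.I * s) ^ a * (f κ).1 Θ) := by
  have h : fieldEval κ s T Θ (monomialFun a α f) =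
    ((Complex.I * s) ^ a * ∏ j, (Complex.I * T j) ^ α j) * (f κ).1 Θ := rfl
  rw [h, weightT, vectorGaussian, Finset.prod_mul_distrib]
  ring

/-- The integrand of the Fourier integral over `s`. -/
def fourierIntegrand (Ψ : Family → ℝ → (Fin n → ℝ) → smoothFun n) (κ : Family) (x : ℝ)
    (Θ : Matrix (Fin n) (Fin n) ℝ) (s : ℝ) : ℂ :=
  Complex.exp (-(Complex.I * (s : ℂ) * (x : ℂ))) * (Complex.exp (-((s : ℂ) ^ 2 / 2)) *
    ((1 / (2 * Real.pi : ℂ) ^ n) * ∫ T, weightT κ T * fieldEval κ s T Θ Ψ))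

theorem fourierIntegrand_monomialFun (a : ℕ) (α : Fin n → ℕ) (f : Family → smoothFun n)
    (κ : Family) (x : ℝ) (Θ : Matrix (Fin n) (Fin n) ℝ) (s : ℝ) :
    fourierIntegrand (monomialFun a α f) κ x Θ s = gaussIntegrand a x s *
      (((1 / (2 * Real.pi : ℂ) ^ n) * ∫ T, vectorGaussian (gamma κ.1) α T) * (f κ).1 Θ) := by
  simp only [fourierIntegrand, weightT_mul_fieldEval_monomialFun]
  rw [integral_mul_const, gaussIntegrand]
  ring

theorem exists_gaussModule_integral_fourierIntegrand
    {Ψ : Family → ℝ → (Fin n → ℝ) → smoothFun n} (hΨ : Ψ ∈ fieldAlg n) :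
    ∃ h ∈ gaussModule (coeffAlg n), ∀ κ x Θ,
      (1 / (2 * Real.pi : ℂ)) * ∫ s, fourierIntegrand Ψ κ x Θ s = (h κ x).1 Θ := by
  -- Integrability in `T` and in `s` is carried along the induction because the integrals are
  -- additive only for integrable terms.
  suffices H : (∀ κ s Θ, Integrable fun T => weightT κ T * fieldEval κ s T Θ Ψ) ∧
      (∀ κ x Θ, Integrable (fourierIntegrand Ψ κ x Θ)) ∧ ∃ h ∈ gaussModule (coeffAlg n), ∀ κ x Θ,
        (1 / (2 * Real.pi : ℂ)) * ∫ s, fourierIntegrand Ψ κ x Θ s = (h κ x).1 Θ from H.2.2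
  induction hΨ using fieldAlg_induction with
  | mon a α f hf =>
    refine ⟨fun κ s Θ => ?_, fun κ x Θ => ?_, ?_⟩
    · simp only [weightT_mul_fieldEval_monomialFun]
      exact (integrable_vectorGaussian κ.2.2.2 α).mul_const _
    · have h := fun s => fourierIntegrand_monomialFun a α f κ x Θ s
      rw [funext h]
      exact (integrable_gaussIntegrand a x).mul_const _
    · obtain ⟨p, hp⟩ := exists_polynomial_integral_gaussIntegrand a
      refine ⟨gaussFun (Polynomial.C (1 / (2 * Real.pi)) * p) (constFun n _ * f),
        gaussFun_mem _ (mul_mem (looplessAlg_le_coeffAlg (constFun_mem_looplessAlg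
          (integral_vectorGaussian_mem_goodAlg α))) hf), fun κ x Θ => ?_⟩
      simp only [fourierIntegrand_monomialFun]
      rw [integral_mul_const, hp]
      change _ = (((Polynomial.C (1 / (2 * Real.pi)) * p).eval x * Real.exp (-x ^ 2 / 2) : ℝ) : ℂ) *
        (((1 / (2 * Real.pi : ℂ) ^ n) * ∫ T, vectorGaussian (gamma κ.1) α T) * (f κ).1 Θ)
      rw [Polynomial.eval_mul, Polynomial.eval_C]
      push_cast
      ring
  | add Ψ Ψ' _ _ ih ih' =>
    obtain ⟨hT, hs, h, hh, hi⟩ := ih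
    obtain ⟨hT', hs', h', hh', hi'⟩ := ih'
    have hsum : ∀ κ s T Θ, weightT κ T * fieldEval κ s T Θ (Ψ + Ψ') =
        weightT κ T * fieldEval κ s T Θ Ψ + weightT κ T * fieldEval κ s T Θ Ψ' := fun κ s T Θ => by
      rw [map_add, mul_add]
    have hF : ∀ κ x Θ, fourierIntegrand (Ψ + Ψ') κ x Θ =
        fourierIntegrand Ψ κ x Θ + fourierIntegrand Ψ' κ x Θ := fun κ x Θ => by
      funext s
      simp only [fourierIntegrand, Pi.add_apply, hsum]
      rw [integral_add (hT κ s Θ) (hT' κ s Θ)]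
      ring
    refine ⟨fun κ s Θ => ?_, fun κ x Θ => ?_, h + h', add_mem hh hh', fun κ x Θ => ?_⟩
    · simp only [hsum]
      exact (hT κ s Θ).add (hT' κ s Θ)
    · rw [hF]
      exact (hs κ x Θ).add (hs' κ x Θ)
    · rw [hF, integral_add' (hs κ x Θ) (hs' κ x Θ), mul_add, hi, hi']
      rfl

/-- The exponent `-(γ tr Θ)² / 2`. -/
def traceExponent (n : ℕ) : Family → smoothFun n := (-1 / 2 : ℝ) • gammaTrace n ^ 2

theorem traceExponent_mem : traceExponent n ∈ looplessAlg n :=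
  (looplessAlg n).smul_mem (pow_mem gammaTrace_mem 2) _

theorem traceExponent_apply (κ : Family) (Θ : Matrix (Fin n) (Fin n) ℝ) :
    (traceExponent n κ).1 Θ = -((gammaTrace n κ).1 Θ) ^ 2 / 2 := by
  change ((-1 / 2 : ℝ) : ℂ) * ((gammaTrace n κ).1 Θ) ^ 2 = _
  push_cast
  ring

/-- The exponential depending on `Θ` alone factors out of the integrals over `s` and `T`. -/
theorem mgfCoeff_eq {m : ℕ} {Ψ : Family → ℝ → (Fin n → ℝ) → smoothFun n}
    (hΨ : ∀ κ s T Θ, fieldEval κ s T Θ Ψ = ∑ r ∈ Finset.range (m + 1),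
      PowerSeries.coeff m (higherCumulants κ.1 (shiftedS κ s Θ)
        (fun i => Complex.I * (T i : ℂ)) Θ ^ r) / (r ! : ℂ))
    (κ : Family) (s : ℝ) (T : Fin n → ℝ) (Θ : Matrix (Fin n) (Fin n) ℝ) :
    mgfCoeff κ.1 m (shiftedS κ s Θ) (fun i => Complex.I * (T i : ℂ)) Θ =
      (expFun (traceExponent n κ + (1 / 2 : ℂ) • secondOrder n κ)).1 Θ *
        Complex.exp (-((s : ℂ) ^ 2 / 2)) * (weightT κ T * fieldEval κ s T Θ Ψ) := by
  have h : (expFun (traceExponent n κ + (1 / 2 : ℂ) • secondOrder n κ)).1 Θ =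
    Complex.exp ((traceExponent n κ).1 Θ + (1 / 2 : ℂ) * (secondOrder n κ).1 Θ) := rfl
  rw [mgfCoeff, ← hΨ, cumulantQ_two_shifted, h, traceExponent_apply, weightT, ← Complex.exp_sum,
    ← mul_assoc, ← Complex.exp_add, ← Complex.exp_add]
  congr 2
  ring

theorem exists_fourierCoeff_eq (m : ℕ) : ∃ h ∈ gaussModule (coeffAlg n), ∀ κ x,
    fourierCoeff κ.1 m x =
      (expFun (traceExponent n κ + (1 / 2 : ℂ) • secondOrder n κ) * h κ x).1 := by
  obtain ⟨Ψ, hΨ, hm⟩ := exists_fieldEval_mgf (n := n) m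
  obtain ⟨h, hh, hi⟩ := exists_gaussModule_integral_fourierIntegrand hΨ
  refine ⟨h, hh, fun κ x => funext fun Θ => ?_⟩
  change _ = (expFun (traceExponent n κ + (1 / 2 : ℂ) • secondOrder n κ)).1 Θ * (h κ x).1 Θ
  rw [← hi, fourierCoeff, mul_left_comm, ← integral_const_mul ((expFun
    (traceExponent n κ + (1 / 2 : ℂ) • secondOrder n κ)).1 Θ)]
  congr 1
  refine integral_congr_ae (Filter.Eventually.of_forall fun s => ?_)
  have hT : ∀ T : Fin n → ℝ, mgfCoeff κ.1 m (Complex.I * (s : ℂ) +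
      ((gamma κ.1 * Θ.trace : ℝ) : ℂ)) (fun i => Complex.I * (T i : ℂ)) Θ = _ :=
    fun T => mgfCoeff_eq hm κ s T Θ
  simp only [mgfVZeroCoeff, hT, fourierIntegrand]
  rw [integral_const_mul]
  ring

theorem exists_detOp_fourierCoeff_eq (m : ℕ) : ∃ h ∈ gaussModule (looplessAlg n), ∀ κ x c,
    detOp c (fourierCoeff (n := n) κ.1 m x) 0 =
      evalZero n (detEnd c (expFun (traceExponent n κ) * h κ x)) := by
  obtain ⟨h, hh, hf⟩ := exists_fourierCoeff_eq (n := n) m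
  obtain ⟨h', hh', hd⟩ := exists_mem_gaussModule_looplessAlg hh
  refine ⟨h', hh', fun κ x c => ?_⟩
  rw [hf, ← detEnd_coe]
  refine evalZero_detEnd_eq_of_sub_mem ?_ c
  have h1 : expFun ((1 / 2 : ℂ) • secondOrder n κ) - 1 ∈ nullIdeal n :=
    expFun_sub_one_mem (by
      rw [Algebra.smul_def]
      exact Ideal.mul_mem_left _ _ (secondOrder_mem_nullIdeal κ))
  rw [expFun_add]
  -- Two replacements modulo `nullIdeal` at once: the exponential of the `ρ''(0)` term by `1`, and
  -- `h` by its loopless representative.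
  have h2 : expFun (traceExponent n κ) * expFun ((1 / 2 : ℂ) • secondOrder n κ) * h κ x -
      expFun (traceExponent n κ) * h' κ x = expFun (traceExponent n κ) *
        (h κ x * (expFun ((1 / 2 : ℂ) • secondOrder n κ) - 1) + (h κ x - h' κ x)) := by ring
  rw [h2]
  exact Ideal.mul_mem_left _ _ (add_mem (Ideal.mul_mem_left _ _ h1) (hd κ x))

end Integrals


/-! ### The determinantal operator on polynomials in `Θ` times a Gaussian -/

theorem thetaDeriv_mem_looplessAlg (i j : Fin n) {f : Family → smoothFun n}
    (hf : f ∈ looplessAlg n) : (fun κ => thetaDeriv i j (f κ)) ∈ looplessAlg n := by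
  induction hf using Algebra.adjoin_induction with
  | mem f h =>
    rcases h with ⟨c, -, rfl⟩ | ⟨p, rfl⟩
    · convert zero_mem (looplessAlg n) using 1
      funext κ
      exact Derivation.map_algebraMap _ _
    · have h : (fun _ : Family => coordCoeff i j p) ∈ goodAlg := by
        convert Subalgebra.algebraMap_mem goodAlg
          (1 / 2 * ((if (i, j) = p then 1 else 0) + (if (j, i) = p then 1 else 0))) using 1
        funext κ
        rw [coordCoeff, Pi.algebraMap_apply, Complex.coe_algebraMap]
        split_ifs <;> simp
      convert constFun_mem_looplessAlg h using 1
      funext κ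
      exact thetaDeriv_coordFun i j p
  | algebraMap r =>
    convert zero_mem (looplessAlg n) using 1
    funext κ
    exact Derivation.map_algebraMap _ (r : ℂ)
  | add f g _ _ hf hg =>
    convert add_mem hf hg using 1
    funext κ
    exact map_add _ _ _
  | mul f g hf' hg' hf hg =>
    convert (looplessAlg n).add_mem ((looplessAlg n).mul_mem hf' hg)
      ((looplessAlg n).mul_mem hg' hf) using 1
    funext κ
    exact Derivation.leibniz _ _ _

/-- Differentiating the exponential returns it times an element of `looplessAlg`, and the diagonal
term `γ x` multiplies `q` by `x` and `f` by `γ`; the form is therefore stable. -/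
theorem exists_entryEnd_eq (i j : Fin n) {h : Family → ℝ → smoothFun n}
    (hh : h ∈ gaussModule (looplessAlg n)) : ∃ h' ∈ gaussModule (looplessAlg n), ∀ κ x,
      entryEnd (gamma κ.1 * x) i j (expFun (traceExponent n κ) * h κ x) =
        expFun (traceExponent n κ) * h' κ x := by
  induction hh using gaussModule_induction with
  | mon q f hf =>
    refine ⟨gaussFun (-q) (f * (fun κ => thetaDeriv i j (traceExponent n κ)) +
        fun κ => thetaDeriv i j (f κ)) +
      gaussFun (if i = j then Polynomial.X * q else 0)
        (constFun n (fun κ => (gamma κ.1 : ℂ)) * f),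
      add_mem (gaussFun_mem _ (add_mem (mul_mem hf (thetaDeriv_mem_looplessAlg i j
        traceExponent_mem)) (thetaDeriv_mem_looplessAlg i j hf)))
        (gaussFun_mem _ (mul_mem (constFun_mem_looplessAlg gamma_mem_goodAlg) hf)),
      fun κ x => ?_⟩
    rw [entryEnd_apply, Derivation.leibniz, thetaDeriv_expFun]
    simp only [gaussFun, Pi.add_apply, Pi.mul_apply, constFun, Derivation.map_smul, smul_eq_mul]
    split_ifs
    · simp only [Polynomial.eval_neg, Polynomial.eval_mul, Polynomial.eval_X, Algebra.smul_def,
        Complex.ofReal_mul, Complex.ofReal_neg, map_mul, map_neg]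
      ring
    · simp only [Polynomial.eval_neg, Polynomial.eval_zero, Algebra.smul_def,
        Complex.ofReal_mul, Complex.ofReal_neg, map_mul, map_neg, Complex.ofReal_zero, map_zero]
      ring
  | add h₁ h₂ _ _ ih₁ ih₂ =>
    obtain ⟨g₁, hg₁, h₁'⟩ := ih₁
    obtain ⟨g₂, hg₂, h₂'⟩ := ih₂
    refine ⟨g₁ + g₂, add_mem hg₁ hg₂, fun κ x => ?_⟩
    simp only [Pi.add_apply]
    rw [mul_add, map_add, h₁', h₂', mul_add]

theorem exists_rowOp_eq (σ : Fin n → Fin n) (l : List (Fin n)) {h : Family → ℝ → smoothFun n}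
    (hh : h ∈ gaussModule (looplessAlg n)) : ∃ h' ∈ gaussModule (looplessAlg n), ∀ κ x,
      rowOp (gamma κ.1 * x) σ l (expFun (traceExponent n κ) * h κ x) =
        expFun (traceExponent n κ) * h' κ x := by
  induction l with
  | nil => exact ⟨h, hh, fun κ x => by simp [rowOp]⟩
  | cons i l ih =>
    obtain ⟨g, hg, hg'⟩ := ih
    obtain ⟨g', hg'', h'⟩ := exists_entryEnd_eq i (σ i) hg
    exact ⟨g', hg'', fun κ x => by rw [rowOp_cons, hg', h']⟩

theorem smul_mem_gaussModule {A : Subalgebra ℝ (Family → smoothFun n)}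
    {h : Family → ℝ → smoothFun n} (r : ℝ) (hh : h ∈ gaussModule A) :
    (fun κ x => (r : ℂ) • h κ x) ∈ gaussModule A := by
  induction hh using gaussModule_induction with
  | mon q f hf =>
    convert gaussFun_mem (Polynomial.C r * q) hf using 1
    funext κ x
    rw [gaussFun, gaussFun, smul_smul, Polynomial.eval_mul, Polynomial.eval_C]
    push_cast
    ring_nf
  | add h₁ h₂ _ _ ih₁ ih₂ =>
    convert add_mem ih₁ ih₂ using 1
    funext κ x
    exact smul_add _ _ _

theorem exists_detEnd_eq {h : Family → ℝ → smoothFun n}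
    (hh : h ∈ gaussModule (looplessAlg n)) : ∃ h' ∈ gaussModule (looplessAlg n), ∀ κ x,
      detEnd (gamma κ.1 * x) (expFun (traceExponent n κ) * h κ x) =
        expFun (traceExponent n κ) * h' κ x := by
  choose g hg hg' using fun σ : Equiv.Perm (Fin n) => exists_rowOp_eq σ (List.finRange n) hh
  refine ⟨∑ σ : Equiv.Perm (Fin n), fun κ x => (((Equiv.Perm.sign σ : ℤ) : ℝ) : ℂ) • g σ κ x,
    sum_mem fun σ _ => smul_mem_gaussModule _ (hg σ), fun κ x => ?_⟩
  simp only [detEnd, LinearMap.sum_apply, LinearMap.smul_apply, hg', Finset.sum_apply,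
    Finset.mul_sum, mul_smul_comm, Complex.ofReal_intCast]

theorem evalZero_mem_goodAlg {f : Family → smoothFun n} (hf : f ∈ looplessAlg n) :
    (fun κ => evalZero n (f κ)) ∈ goodAlg := by
  induction hf using Algebra.adjoin_induction with
  | mem f h =>
    rcases h with ⟨c, hc, rfl⟩ | ⟨p, rfl⟩
    · exact hc
    · convert zero_mem goodAlg using 1
      funext κ
      change (((0 : Matrix (Fin n) (Fin n) ℝ) p.1 p.2 : ℝ) : ℂ) = 0
      simp
  | algebraMap r => exact Subalgebra.algebraMap_mem goodAlg r
  | add f g _ _ hf hg => exact add_mem hf hg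
  | mul f g _ _ hf hg => exact mul_mem hf hg

theorem evalZero_expFun_traceExponent (κ : Family) :
    evalZero n (expFun (traceExponent n κ)) = 1 := by
  change Complex.exp ((traceExponent n κ).1 0) = 1
  rw [traceExponent_apply, gammaTrace_apply]
  simp

/-! ### The integral over the level -/

section Level

open MeasureTheory

theorem integrable_polynomial_mul_gaussian (q : Polynomial ℝ) :
    Integrable fun x : ℝ => q.eval x * Real.exp (-x ^ 2 / 2) := by
  induction q using Polynomial.induction_on' with
  | add p q hp hq =>
    simp only [Polynomial.eval_add, add_mul]
    exact hp.add hq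
  | monomial k a =>
    have h := integrable_rpow_mul_exp_neg_mul_sq (b := 1 / 2) (by norm_num)
      (lt_of_lt_of_le neg_one_lt_zero (Nat.cast_nonneg k))
    simp only [Real.rpow_natCast] at h
    refine (h.const_mul a).congr (Filter.Eventually.of_forall fun x => ?_)
    simp only [Polynomial.eval_monomial]
    rw [mul_assoc]
    congr 3
    ring

theorem integral_evalZero_mem_goodAlg {h : Family → ℝ → smoothFun n}
    (hh : h ∈ gaussModule (looplessAlg n)) (v : ℝ) :
    (fun κ => ∫ x in Set.Ioi v, evalZero n (h κ x)) ∈ goodAlg := by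
  suffices H : (∀ κ, IntegrableOn (fun x => evalZero n (h κ x)) (Set.Ioi v)) ∧
      (fun κ => ∫ x in Set.Ioi v, evalZero n (h κ x)) ∈ goodAlg from H.2
  induction hh using gaussModule_induction with
  | mon q f hf =>
    have h : ∀ κ x, evalZero n (gaussFun q f κ x) =
        ((q.eval x * Real.exp (-x ^ 2 / 2) : ℝ) : ℂ) * evalZero n (f κ) :=
      fun κ x => map_smul (evalZero n) _ _
    simp only [h]
    refine ⟨fun κ => (integrable_polynomial_mul_gaussian q).integrableOn.ofReal.mul_const _, ?_⟩
    -- The level `v` enters only through this real number, which is the same for all families.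
    convert goodAlg.smul_mem (evalZero_mem_goodAlg hf)
      (∫ x in Set.Ioi v, q.eval x * Real.exp (-x ^ 2 / 2)) using 1
    funext κ
    rw [integral_mul_const, integral_complex_ofReal, Pi.smul_apply, Complex.real_smul]
  | add h₁ h₂ _ _ ih₁ ih₂ =>
    simp only [Pi.add_apply, map_add]
    refine ⟨fun κ => (ih₁.1 κ).add (ih₂.1 κ), ?_⟩
    convert add_mem ih₁.2 ih₂.2 using 1
    funext κ
    exact integral_add (ih₁.1 κ) (ih₂.1 κ)

theorem eulerDensityCoeff_mem_goodAlg (n m : ℕ) (v : ℝ) :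
    (fun κ : Family => eulerDensityCoeff κ.1 n m v) ∈ goodAlg := by
  obtain ⟨h, hh, hd⟩ := exists_detOp_fourierCoeff_eq (n := n) m
  obtain ⟨h', hh', hd'⟩ := exists_detEnd_eq hh
  convert integral_evalZero_mem_goodAlg hh' v using 1
  funext κ
  simp only [eulerDensityCoeff, hd, hd', evalZero_mul, evalZero_expFun_traceExponent, one_mul]

end Level

end ECDensity
end

theorem theorem2 (n m : ℕ) (v : ℝ) :
    ∃ P : MvPolynomial (Option ECDensity.Diagram) ℝ,
      (∀ κ : ECDensity.PointFunctions,
        (∀ N, ContDiff ℝ (⊤ : ℕ∞) (κ N)) → ECDensity.rho κ 0 = 1 → 0 < ECDensity.gamma κ →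
          ECDensity.eulerDensityCoeff κ n m v =
            ((MvPolynomial.eval
              (fun d : Option ECDensity.Diagram =>
                d.elim (1 / Real.sqrt (ECDensity.gamma κ)) (fun D => D.derivative κ)) P : ℝ) : ℂ)) ∧
      ∀ (D : ECDensity.Diagram) (K : ℕ), 2 ≤ K → D.HasLoop K → some D ∉ P.vars := by
  obtain ⟨P, hP, hv⟩ := ECDensity.exists_polynomial_of_mem_goodAlg
    (ECDensity.eulerDensityCoeff_mem_goodAlg n m v)
  exact ⟨P, fun κ hκ h0 hγ => hP ⟨κ, hκ, h0, hγ⟩, fun D K hK hD hmem => hv D hmem K hK hD⟩
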